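/- **Theorem 2.** Let $\mathfrak a = 1/\sqrt2$ and $\varphi(t)=2^{1/4}e^{-\pi t^2}$. For $p=(x,\omega)\in\mathbb R^2$ and $g\in L^2(\mathbb R)$ let $(\pi(p)g)(t)=e^{2\pi i\omega t}g(t-x)$, and for $f\in L^2(\mathbb R)$ let $$\mathcal G f(p)=\langle f,\pi(p)\varphi\rangle_{L^2(\mathbb R)}=2^{1/4}\int_{\mathbb R}f(t)e^{-\pi(t-x)^2}e^{-2\pi i\omega t}\,dt .$$ Let $\psi=\mathbf S^{-1}\varphi$ be the canonical dual window of the Gabor frame $(\pi(\lambda)\varphi)_{\lambda\in\mathfrak a\mathbb Z^2}$, where $\mathbf S h=\sum_{\lambda\in\mathfrak a\mathbb Z^2}\langle h,\pi(\lambda)\varphi\rangle\,\pi(\lambda)\varphi$ is its frame operator on $L^2(\mathbb R)$. For a finite set $\Lambda\subset\mathfrak a\mathbb Z^2$ and $c\in\mathbb C^\Lambda$ put $\mathcal R_\Lambda(c)=\sum_{\lambda\in\Lambda}c_\lambda\,\pi(\lambda)\psi$. For $f\in L^2(\mathbb R)$ and $S\ge 0$ put $$\kappa_S(f)=\sup_{x\in\mathbb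 R}\Big(\int_{|\omega|>S}|\mathcal G f(x,\omega)|^2\,d\omega\Big)^{1/2},\qquad \eta(f)=\sup_{x\in\mathbb R}\Big(\int_{\mathbb R}|f(t)|^2\varphi(t-x)\,dt\Big)^{1/2}.$$ Let $T,S\in\mathfrak a\mathbb N$ (with $0\in\mathbb N$), let $0<\tau<T$, and let $\Lambda=([-T,T]\times[-S,S])\cap\mathfrak a\mathbb Z^2$. Then for all $f\in L^2(\mathbb R)$ and all $c\in\mathbb C^\Lambda$, $$\|f-\mathcal R_\Lambda(c)\|_{L^2(-\tau,\tau)}\le 6.82\Big(\Big(\sum_{\lambda\in\Lambda}|\mathcal G f(\lambda)-c_\lambda|^2\Big)^{1/2}+\sqrt{T+1}\,\kappa_S(f)+\sqrt{\tau+1}\;e^{-\frac{\pi}{\sqrt2}(T-\tau)}\,\eta(f)\Big).$$ -/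

import Mathlib

open MeasureTheory Set
open scoped ENNReal

noncomputable section

namespace Gabor

/-- The Hilbert space `L²(ℝ)` of complex-valued functions with respect to Lebesgue measure. -/
abbrev L2 : Type := Lp ℂ 2 (volume : Measure ℝ)

/-- The mesh size `𝔞 = 1/√2`. -/
def mesh : ℝ := 1 / √2

/-- The Gaussian `φ(t) = 2^{1/4} e^{-π t²}`. -/
def gaussianFun (t : ℝ) : ℝ := (2 : ℝ) ^ (1 / 4 : ℝ) * Real.exp (-Real.pi * t ^ 2)

theorem memLp_gaussianFun : MemLp (fun t : ℝ => (gaussianFun t : ℂ)) 2 volume := by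
  have hc : Continuous fun t : ℝ => (gaussianFun t : ℂ) := by
    unfold gaussianFun
    fun_prop
  rw [memLp_two_iff_integrable_sq_norm hc.aestronglyMeasurable]
  have h := (integrable_exp_neg_mul_sq (b := 2 * Real.pi) (by positivity)).const_mul
    (((2 : ℝ) ^ (1 / 4 : ℝ)) ^ 2)
  refine h.congr (Filter.Eventually.of_forall fun t => ?_)
  simp only [gaussianFun, Complex.norm_real, Real.norm_eq_abs, sq_abs, mul_pow,
    ← Real.exp_nat_mul]
  congr 2
  push_cast
  ring

/-- The Gaussian as an element of `L²(ℝ)`. -/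
def gaussian : L2 := memLp_gaussianFun.toLp _

theorem memLp_tfShift (p : ℝ × ℝ) (g : L2) :
    MemLp (fun t : ℝ => Complex.exp (2 * Real.pi * Complex.I * p.2 * t) * g (t - p.1))
      2 volume := by
  have h : MemLp (fun t : ℝ => g (t - p.1)) 2 volume :=
    (Lp.memLp g).comp_measurePreserving (measurePreserving_sub_right volume p.1)
  have hc : Continuous fun t : ℝ => Complex.exp (2 * Real.pi * Complex.I * p.2 * t) := by
    fun_prop
  refine h.congr_norm (hc.aestronglyMeasurable.mul h.aestronglyMeasurable)
    (Filter.Eventually.of_forall fun t => ?_)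
  have : (2 * Real.pi * Complex.I * p.2 * t : ℂ) = ((2 * Real.pi * p.2 * t : ℝ) : ℂ) * Complex.I := by
    push_cast
    ring
  rw [norm_mul, this, Complex.norm_exp_ofReal_mul_I, one_mul]

/-- The time-frequency shift `π(x, ω) g (t) = e^{2πiωt} g(t - x)` on `L²(ℝ)`. -/
def tfShift (p : ℝ × ℝ) (g : L2) : L2 := (memLp_tfShift p g).toLp _

/-- The Gabor transform `𝒢 f(p) = ⟨f, π(p) φ⟩`, the inner product being linear in `f`
(Mathlib's `inner` is conjugate-linear in its first argument). -/
def gaborTransform (f : L2) (p : ℝ × ℝ) : ℂ := inner ℂ (tfShift p gaussian) f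

/-- The square lattice `𝔞ℤ²`. -/
def lattice : Set (ℝ × ℝ) := Set.range fun n : ℤ × ℤ => (mesh * n.1, mesh * n.2)

/-- The frame operator `f ↦ ∑ᵢ ⟨f, eᵢ⟩ eᵢ` of a family of vectors in `L²(ℝ)`. -/
def frameOperator {ι : Type} (e : ι → L2) (f : L2) : L2 := ∑' i, inner ℂ (e i) f • e i

/-- The Gaussian Gabor system `(π(p) φ)`, `p ∈ 𝔞ℤ²`. -/
def gaborSystem (p : lattice) : L2 := tfShift p gaussian

/-- The canonical dual window `ψ = S⁻¹ φ`, with `S` the frame operator of the Gabor system. -/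
def dualWindow : L2 := Function.invFun (frameOperator gaborSystem) gaussian

theorem finite_box (T S : ℝ) : ((Icc (-T) T ×ˢ Icc (-S) S) ∩ lattice).Finite := by
  have hm : 0 < mesh := by unfold mesh; positivity
  refine ((finite_Icc (⌈-T / mesh⌉, ⌈-S / mesh⌉) (⌊T / mesh⌋, ⌊S / mesh⌋)).image
    fun n : ℤ × ℤ => (mesh * (n.1 : ℝ), mesh * (n.2 : ℝ))).subset ?_
  rintro _ ⟨⟨⟨h1, h2⟩, ⟨h3, h4⟩⟩, ⟨n, rfl⟩⟩
  refine ⟨n, ⟨⟨Int.ceil_le.2 ?_, Int.ceil_le.2 ?_⟩, ⟨Int.le_floor.2 ?_, Int.le_floor.2 ?_⟩⟩, rfl⟩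
  · rw [div_le_iff₀ hm, mul_comm]; exact h1
  · rw [div_le_iff₀ hm, mul_comm]; exact h3
  · rw [le_div_iff₀ hm, mul_comm]; exact h2
  · rw [le_div_iff₀ hm, mul_comm]; exact h4

/-- The finite index set `Λ = ([-T, T] × [-S, S]) ∩ 𝔞ℤ²`. -/
def box (T S : ℝ) : Finset (ℝ × ℝ) := (finite_box T S).toFinset

/-- The synthesis operator `ℛ_Λ(c) = ∑_{p ∈ Λ} c_p π(p) ψ`. -/
def synthesis (Λ : Finset (ℝ × ℝ)) (c : Λ → ℂ) : L2 := ∑ p : Λ, c p • tfShift p dualWindow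

/-- The `ℓ²` norm of a vector indexed by a finite set. -/
def l2Norm {Λ : Finset (ℝ × ℝ)} (v : Λ → ℂ) : ℝ := √(∑ p : Λ, ‖v p‖ ^ 2)

/-- `η(f) = sup_x ‖f · T_x φ^{1/2}‖_{L²}`. -/
def eta (f : L2) : ℝ≥0∞ :=
  ⨆ x : ℝ, eLpNorm (fun t => f t * (√(gaussianFun (t - x)) : ℂ)) 2 volume

/-- `κ_S(f) = sup_x (∫_{|ω| > S} |𝒢 f(x, ω)|² dω)^{1/2}`. -/
def kappa (S : ℝ) (f : L2) : ℝ≥0∞ :=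
  ⨆ x : ℝ, eLpNorm (fun ω => gaborTransform f (x, ω)) 2 (volume.restrict {ω : ℝ | S < |ω|})

end Gabor

end

noncomputable section

namespace Gabor

/-! ### Sums over the integers -/

/-! The frame operator of this lattice can be inverted explicitly. Poisson summation in the
frequency variable writes it as a sum over translations by `√2 * j`. Because `√2` is twice the mesh,
the Gaussian factors separate, and the operator becomes multiplication by the periodic function
`weight` followed or preceded by convolution with `e^{-πj²}` on `√2 ℤ` (`frameOperator_gaborAtom`);
the two factors commute. The multiplier stays close to 2, since its theta series is nearly constant.
The sequence `q^{j²}`, `q = e^{-π}`, has a convolution inverse built from alternating tails of `∑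
(-1)^k q^{k(k+1)}`, which decays like `q^{|j|}` (`exists_conv_inverse`). Hence `frameInv` has norm
at most `7/10`, commutes with the lattice time-frequency shifts, and has exponential off-diagonal
decay in time at rate `π/√2`.

Consequently `f` is the sum of its Gabor coefficients against `frameInv (gaborAtom z)`, and the
error splits into three sums. Inside the box the operator norm and the Bessel bound `2.01²` from
Schur's test suffice (`norm_frameInv_tsum_le`). For times in the box but frequencies outside, the
same bound applies, and the samples are controlled by `kappa` through the mean value property of an
entire function attached to the Bargmann transform (`sum_sq_gaborTransform_le`). For times outside
the box, each column of the lattice yields a trigonometric polynomial times an envelope decaying at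
rate `π/√2` (`ae_norm_frameInv_sum_le`); `eta` controls its coefficients, and the columns sum
geometrically (`norm_restrictL2_timeTail_le`). -/

theorem hasSum_pow_natAbs {q : ℝ} (h0 : 0 ≤ q) (h1 : q < 1) :
    HasSum (fun n : ℤ => q ^ n.natAbs) ((1 + q) / (1 - q)) := by
  have h := hasSum_geometric_of_lt_one h0 h1
  have h2 : HasSum (fun n : ℕ => q ^ (n + 1)) (q / (1 - q)) := by
    simpa [pow_succ', div_eq_mul_inv] using h.mul_left q
  have := HasSum.of_nat_of_neg_add_one (f := fun n : ℤ => q ^ n.natAbs) (by simpa using h)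
    (by
      convert h2 using 2 with n
      congr 1)
  convert this using 1
  rw [inv_eq_one_div, ← add_div]

/-- The periodized Gaussian `∑ₖ e^{-π s (t - k)²}`. -/
def periodizedGaussian (s t : ℝ) : ℝ := ∑' k : ℤ, Real.exp (-Real.pi * s * (t - k) ^ 2)

theorem exp_neg_pi_mul_sq_le_pow (s : ℝ) (hs : 0 < s) (n : ℤ) :
    Real.exp (-Real.pi * s * n ^ 2) ≤ Real.exp (-Real.pi * s) ^ n.natAbs := by
  rw [← Real.exp_nat_mul]
  apply Real.exp_le_exp.2
  have h1 : ((n.natAbs : ℝ)) ≤ (n : ℝ) ^ 2 := by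
    have h := Int.natAbs_le_self_sq n
    rw [← Int.cast_natCast n.natAbs]
    exact_mod_cast h
  have := mul_le_mul_of_nonneg_left h1 (mul_pos Real.pi_pos hs).le
  nlinarith

theorem exp_neg_pi_mul_lt_one {s : ℝ} (hs : 0 < s) : Real.exp (-Real.pi * s) < 1 := by
  rw [Real.exp_lt_one_iff]
  have := mul_pos Real.pi_pos hs
  linarith

theorem summable_exp_neg_pi_mul_sq {s : ℝ} (hs : 0 < s) (t : ℝ) :
    Summable fun k : ℤ => Real.exp (-Real.pi * s * (t - k) ^ 2) := by
  have hρ : Summable fun k : ℤ => Real.exp (-Real.pi * (s / 2)) ^ k.natAbs :=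
    (hasSum_pow_natAbs (Real.exp_pos _).le (exp_neg_pi_mul_lt_one (half_pos hs))).summable
  refine Summable.of_nonneg_of_le (fun k => (Real.exp_pos _).le) (fun k => ?_)
    (hρ.mul_left (Real.exp (Real.pi * s * t ^ 2)))
  refine le_trans ?_ (mul_le_mul_of_nonneg_left
    (exp_neg_pi_mul_sq_le_pow (s / 2) (half_pos hs) k) (Real.exp_pos _).le)
  rw [← Real.exp_add]
  apply Real.exp_le_exp.2
  -- The identity used is `(t - k)² = k²/2 - t² + (2t - k)²/2`.
  have := mul_nonneg (mul_pos Real.pi_pos hs).le (sq_nonneg (2 * t - k))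
  nlinarith

/-- Jacobi's theta inversion at the parameter `s⁻¹`. For small `s` the dual side converges fast, and
its terms have moduli independent of `t`. -/
theorem sqrt_mul_periodizedGaussian {s : ℝ} (hs : 0 < s) (t : ℝ) :
    ((√s * periodizedGaussian s t : ℝ) : ℂ) =
      ∑' n : ℤ, Complex.exp (-Real.pi / s * n ^ 2 + 2 * Real.pi * (Complex.I * t) * n) := by
  have hre : 0 < ((s⁻¹ : ℝ) : ℂ).re := by simpa using hs
  have h := Complex.tsum_exp_neg_quadratic hre (Complex.I * t)
  have hc : (1 : ℂ) / ((s⁻¹ : ℝ) : ℂ) ^ (1 / 2 : ℂ) = ((√s : ℝ) : ℂ) := by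
    rw [Real.sqrt_eq_rpow, show (1 / 2 : ℂ) = ((1 / 2 : ℝ) : ℂ) by norm_num,
      ← Complex.ofReal_cpow (inv_nonneg.2 hs.le), Real.inv_rpow hs.le]
    push_cast
    simp
  rw [hc] at h
  have e1 : ∀ n : ℤ, Complex.exp (-Real.pi / s * n ^ 2 + 2 * Real.pi * (Complex.I * t) * n) =
      Complex.exp (-Real.pi * ((s⁻¹ : ℝ) : ℂ) * n ^ 2 + 2 * Real.pi * (Complex.I * t) * n) := by
    intro n
    push_cast
    rw [div_eq_mul_inv]
  simp_rw [e1]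
  rw [h, periodizedGaussian]
  push_cast
  congr 1
  refine tsum_congr fun n => ?_
  congr 1
  have hI : Complex.I * (Complex.I * (t : ℂ)) = -t := by
    rw [← mul_assoc, Complex.I_mul_I]; ring
  rw [hI, div_inv_eq_mul]
  ring

/-- On the dual side the term `n = 0` equals 1 and the others are dominated by `ρ^|n|`, a two-sided
geometric series. The numerical bounds on periodized Gaussians all come from here. -/
theorem abs_sqrt_mul_periodizedGaussian_sub_one_le {s : ℝ} (hs : 0 < s) (t : ℝ) :
    |√s * periodizedGaussian s t - 1| ≤
      2 * Real.exp (-Real.pi * s⁻¹) / (1 - Real.exp (-Real.pi * s⁻¹)) := by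
  set ρ := Real.exp (-Real.pi * s⁻¹) with hρ
  have hs' : 0 < s⁻¹ := inv_pos.2 hs
  have hρ1 : ρ < 1 := exp_neg_pi_mul_lt_one hs'
  have hρ0 : 0 < ρ := Real.exp_pos _
  have hnorm : ∀ n : ℤ, ‖Complex.exp (-Real.pi / s * n ^ 2 + 2 * Real.pi * (Complex.I * t) * n)‖
      = Real.exp (-Real.pi * s⁻¹ * n ^ 2) := by
    intro n
    rw [show (-Real.pi / s * n ^ 2 + 2 * Real.pi * (Complex.I * t) * n : ℂ) =
      ((-Real.pi * s⁻¹ * n ^ 2 : ℝ) : ℂ) + ((2 * Real.pi * t * n : ℝ) : ℂ) * Complex.I by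
        push_cast; rw [div_eq_mul_inv]; ring, Complex.exp_add, norm_mul,
      Complex.norm_exp_ofReal_mul_I, mul_one, ← Complex.ofReal_exp, Complex.norm_real,
      Real.norm_of_nonneg (Real.exp_pos _).le]
  have hle : ∀ n : ℤ,
      ‖Complex.exp (-Real.pi / s * n ^ 2 + 2 * Real.pi * (Complex.I * t) * n)‖ ≤ ρ ^ n.natAbs :=
    fun n => (hnorm n).trans_le (exp_neg_pi_mul_sq_le_pow _ hs' n)
  have hS := hasSum_pow_natAbs hρ0.le hρ1
  have hsum : Summable fun n : ℤ =>
      Complex.exp (-Real.pi / s * n ^ 2 + 2 * Real.pi * (Complex.I * t) * n) :=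
    Summable.of_norm_bounded hS.summable hle
  have h1 := hsum.hasSum.sub (hasSum_ite_eq (0 : ℤ) (1 : ℂ))
  have h2 := hS.sub (hasSum_ite_eq (0 : ℤ) (1 : ℝ))
  have key := tsum_of_norm_bounded h2 (f := fun n : ℤ =>
      Complex.exp (-Real.pi / s * n ^ 2 + 2 * Real.pi * (Complex.I * t) * n)
        - if n = 0 then 1 else 0) (fun n => by
    by_cases hn : n = 0
    · subst hn; simp
    · simpa [hn] using hle n)
  rw [h1.tsum_eq, ← sqrt_mul_periodizedGaussian hs] at key
  have : ‖((√s * periodizedGaussian s t : ℝ) : ℂ) - 1‖ = |√s * periodizedGaussian s t - 1| := by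
    rw [← Complex.ofReal_one, ← Complex.ofReal_sub, Complex.norm_real, Real.norm_eq_abs]
  rw [this] at key
  refine key.trans_eq ?_
  have : 1 - ρ ≠ 0 := by linarith
  field_simp
  ring

/-! ### The convolution inverse of `q ^ (m ^ 2)` -/

/-- The alternating tails `∑_{k ≥ n} (-1)ᵏ q^{k(k+1)}`. -/
def alternatingTail (q : ℝ) (n : ℕ) : ℝ :=
  ∑' i : ℕ, (-1 : ℝ) ^ (n + i) * q ^ ((n + i) * (n + i + 1))

theorem pow_alternatingTail_le {q : ℝ} (h0 : 0 < q) (h1 : q < 1) (n i : ℕ) :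
    ‖(-1 : ℝ) ^ (n + i) * q ^ ((n + i) * (n + i + 1))‖ ≤ q ^ (n * (n + 1)) * q ^ i := by
  rw [norm_mul, norm_pow, norm_neg, norm_one, one_pow, one_mul, norm_pow,
    Real.norm_of_nonneg h0.le, ← pow_add]
  exact pow_le_pow_of_le_one h0.le h1.le (by nlinarith)

theorem summable_alternatingTail {q : ℝ} (h0 : 0 < q) (h1 : q < 1) (n : ℕ) :
    Summable fun i : ℕ => (-1 : ℝ) ^ (n + i) * q ^ ((n + i) * (n + i + 1)) :=
  Summable.of_norm_bounded ((summable_geometric_of_lt_one h0.le h1).mul_left _)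
    (pow_alternatingTail_le h0 h1 n)

theorem abs_alternatingTail_le {q : ℝ} (h0 : 0 < q) (h1 : q < 1) (n : ℕ) :
    |alternatingTail q n| ≤ q ^ (n * (n + 1)) / (1 - q) :=
  tsum_of_norm_bounded ((hasSum_geometric_of_lt_one h0.le h1).mul_left _)
    (pow_alternatingTail_le h0 h1 n)

theorem alternatingTail_eq_add {q : ℝ} (h0 : 0 < q) (h1 : q < 1) (n : ℕ) :
    alternatingTail q n = (-1) ^ n * q ^ (n * (n + 1)) + alternatingTail q (n + 1) := by
  rw [alternatingTail, (summable_alternatingTail h0 h1 n).tsum_eq_zero_add, alternatingTail]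
  congr 1
  refine tsum_congr fun i => ?_
  rw [show n + (i + 1) = n + 1 + i by ring]

/-- Under `k ↦ -1 - k` the exponent `k(k+1)` is fixed and the sign flips. This is why the even
extension of the tails obeys the same recursion at negative indices. -/
theorem alternatingTail_natAbs_sub {q : ℝ} (h0 : 0 < q) (h1 : q < 1) (m : ℤ) :
    alternatingTail q m.natAbs - alternatingTail q (m + 1).natAbs
      = (-1) ^ m * q ^ (m * (m + 1)) := by
  obtain ⟨n, rfl | rfl⟩ := m.eq_nat_or_neg
  · have e : ((n : ℤ) + 1).natAbs = n + 1 := by omega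
    rw [e, Int.natAbs_natCast, alternatingTail_eq_add h0 h1 n]
    have : ((n : ℤ) * (n + 1)) = ((n * (n + 1) : ℕ) : ℤ) := by push_cast; ring
    rw [this, zpow_natCast, zpow_natCast]
    ring
  · cases n with
    | zero =>
      have := alternatingTail_eq_add h0 h1 0
      simp at this ⊢
      linarith
    | succ n =>
      have e : (-((n + 1 : ℕ) : ℤ) + 1).natAbs = n := by omega
      have e' : (-((n + 1 : ℕ) : ℤ)).natAbs = n + 1 := by omega
      rw [e, e', alternatingTail_eq_add h0 h1 n]
      have : (-((n + 1 : ℕ) : ℤ) * (-((n + 1 : ℕ) : ℤ) + 1)) = ((n * (n + 1) : ℕ) : ℤ) := by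
        push_cast; ring
      rw [this, zpow_natCast, zpow_neg, zpow_natCast, ← inv_pow, inv_neg_one, pow_succ]
      ring

theorem abs_alternatingTail_natAbs_le {q : ℝ} (h0 : 0 < q) (h1 : q < 1) (m : ℤ) :
    |alternatingTail q m.natAbs| ≤ q ^ (m ^ 2) * q ^ m.natAbs / (1 - q) := by
  refine (abs_alternatingTail_le h0 h1 _).trans_eq ?_
  congr 1
  rw [← Int.natAbs_sq, ← zpow_natCast, ← zpow_natCast, ← zpow_add₀ h0.ne']
  congr 1
  push_cast
  ring

/-- The tail is of size `q^{m² + |m|}`, so the growing factor `q^{-m²}` still leaves the decay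
`q^{|m|}`. -/
theorem norm_conv_alternatingTail_le {q : ℝ} (h0 : 0 < q) (h1 : q < 1) (l m : ℤ) :
    ‖q ^ ((l - m) ^ 2) * (q ^ (-m ^ 2) * alternatingTail q m.natAbs)‖
      ≤ q ^ m.natAbs / (1 - q) := by
  have hA := abs_alternatingTail_natAbs_le h0 h1 m
  have hq : 0 < 1 - q := by linarith
  have hz : ∀ n : ℤ, 0 < q ^ n := fun n => zpow_pos h0 n
  rw [norm_mul, norm_mul, Real.norm_of_nonneg (hz _).le, Real.norm_of_nonneg (hz _).le,
    Real.norm_eq_abs]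
  have h2 : q ^ ((l - m) ^ 2) ≤ 1 := by
    rw [← Int.toNat_of_nonneg (sq_nonneg (l - m)), zpow_natCast]
    exact pow_le_one₀ h0.le h1.le
  calc _ ≤ 1 * (q ^ (-m ^ 2) * (q ^ (m ^ 2) * q ^ m.natAbs / (1 - q))) := by
        gcongr
    _ = _ := by
        rw [zpow_neg]
        field_simp [(hz (m ^ 2)).ne']

theorem summable_conv_alternatingTail {q : ℝ} (h0 : 0 < q) (h1 : q < 1) (l : ℤ) :
    Summable fun m : ℤ => q ^ ((l - m) ^ 2) * (q ^ (-m ^ 2) * alternatingTail q m.natAbs) :=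
  Summable.of_norm_bounded ((hasSum_pow_natAbs h0.le h1).summable.div_const _)
    (norm_conv_alternatingTail_le h0 h1 l)

/-- The reflection `n ↦ -1 - n` turns the sum into its own negative. -/
theorem tsum_neg_one_zpow_mul_eq_zero (q : ℝ) : ∑' n : ℤ, (-1 : ℝ) ^ n * q ^ (n * (n + 1)) = 0 := by
  have e : ∑' n : ℤ, (-1 : ℝ) ^ n * q ^ (n * (n + 1))
      = ∑' n : ℤ, -((-1 : ℝ) ^ n * q ^ (n * (n + 1))) := by
    rw [← (Equiv.subLeft (-1 : ℤ)).tsum_eq]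
    refine tsum_congr fun n => ?_
    simp only [Equiv.subLeft_apply]
    rw [show (-1 - n) * (-1 - n + 1) = n * (n + 1) by ring,
      zpow_sub₀ (by norm_num : (-1 : ℝ) ≠ 0)]
    have : ((-1 : ℝ) ^ n)⁻¹ = (-1) ^ n := by
      rw [← inv_zpow, inv_neg_one]
    rw [div_eq_mul_inv, this]
    simp
  rw [tsum_neg] at e
  linarith

/-- If `A m` denotes the summand, then `A m - q^{2l} A (m + 1)` is a multiple of a translate of the
alternating series with sum zero. Summing over `m` gives `(1 - q^{2l}) ∑ A = 0`, and the first
factor vanishes only for `l = 0`. -/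
theorem tsum_conv_alternatingTail_eq_zero {q : ℝ} (h0 : 0 < q) (h1 : q < 1) {l : ℤ} (hl : l ≠ 0) :
    ∑' m : ℤ, q ^ ((l - m) ^ 2) * (q ^ (-m ^ 2) * alternatingTail q m.natAbs) = 0 := by
  set A : ℤ → ℝ := fun m => q ^ ((l - m) ^ 2) * (q ^ (-m ^ 2) * alternatingTail q m.natAbs) with hA
  have hs : Summable A := summable_conv_alternatingTail h0 h1 l
  have hs' : Summable fun m => A (m + 1) := (Equiv.addRight (1 : ℤ)).summable_iff.2 hs
  have hshift : ∑' m, A (m + 1) = ∑' m, A m := (Equiv.addRight (1 : ℤ)).tsum_eq A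
  have hrec : ∀ m, A m - q ^ (2 * l) * A (m + 1)
      = (q ^ l * (-1) ^ l) * ((-1) ^ (m - l) * q ^ ((m - l) * (m - l + 1))) := by
    intro m
    have h := alternatingTail_natAbs_sub h0 h1 m
    have e1 : q ^ ((l - m) ^ 2) * q ^ (-m ^ 2) = q ^ (l ^ 2 - 2 * l * m) := by
      rw [← zpow_add₀ h0.ne']; ring_nf
    have e2 : q ^ (2 * l) * (q ^ ((l - (m + 1)) ^ 2) * q ^ (-(m + 1) ^ 2))
        = q ^ (l ^ 2 - 2 * l * m) := by
      rw [← zpow_add₀ h0.ne', ← zpow_add₀ h0.ne']; ring_nf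
    have e3 : q ^ (l ^ 2 - 2 * l * m) * q ^ (m * (m + 1)) =
        q ^ l * q ^ ((m - l) * (m - l + 1)) := by
      rw [← zpow_add₀ h0.ne', ← zpow_add₀ h0.ne']; ring_nf
    have e4 : (-1 : ℝ) ^ l * (-1) ^ (m - l) = (-1) ^ m := by
      rw [← zpow_add₀ (by norm_num)]; ring_nf
    calc A m - q ^ (2 * l) * A (m + 1)
        = (q ^ ((l - m) ^ 2) * q ^ (-m ^ 2)) * alternatingTail q m.natAbs
          - (q ^ (2 * l) * (q ^ ((l - (m + 1)) ^ 2) * q ^ (-(m + 1) ^ 2)))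
            * alternatingTail q (m + 1).natAbs := by simp only [hA]; ring
      _ = q ^ (l ^ 2 - 2 * l * m) * ((-1) ^ m * q ^ (m * (m + 1))) := by
          rw [e1, e2, ← mul_sub, h]
      _ = (q ^ (l ^ 2 - 2 * l * m) * q ^ (m * (m + 1))) * (-1) ^ m := by ring
      _ = _ := by rw [e3, ← e4]; ring
  have hsum : ∑' m, (A m - q ^ (2 * l) * A (m + 1)) = 0 := by
    simp_rw [hrec]
    rw [tsum_mul_left]
    have := (Equiv.subRight l).tsum_eq (fun m : ℤ => (-1 : ℝ) ^ m * q ^ (m * (m + 1)))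
    simp only [Equiv.subRight_apply] at this
    rw [this, tsum_neg_one_zpow_mul_eq_zero q, mul_zero]
  rw [hs.tsum_sub (hs'.mul_left _), tsum_mul_left, hshift] at hsum
  have hne : 1 - q ^ (2 * l) ≠ 0 := by
    intro h
    have h2 : q ^ (2 * l) = q ^ (0 : ℤ) := by rw [zpow_zero]; linarith
    have := (zpow_right_injective₀ h0 h1.ne) h2
    omega
  have : (1 - q ^ (2 * l)) * ∑' m, A m = 0 := by linarith
  exact (mul_eq_zero.1 this).resolve_left hne

/-- At `l = 0` the quadratic exponents cancel and the tails themselves are summed. The central one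
is at least `1 - 1/380`; the rest are bounded by a geometric series in `q²`, since `n(n+1) ≥ 2n`. -/
theorem le_tsum_alternatingTail {q : ℝ} (h0 : 0 < q) (hq : q ≤ 1 / 20) :
    99 / 100 ≤ ∑' m : ℤ, q ^ ((0 - m) ^ 2) * (q ^ (-m ^ 2) * alternatingTail q m.natAbs) := by
  have h1 : q < 1 := by linarith
  have hs := summable_conv_alternatingTail h0 h1 0
  have e : ∀ m : ℤ, q ^ ((0 - m) ^ 2) * (q ^ (-m ^ 2) * alternatingTail q m.natAbs)
      = alternatingTail q m.natAbs := by
    intro m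
    rw [← mul_assoc, ← zpow_add₀ h0.ne']
    simp
  simp_rw [e] at hs ⊢
  have hb : ∀ n : ℕ, |alternatingTail q n| ≤ q ^ (2 * n) / (1 - q) := fun n =>
    (abs_alternatingTail_le h0 h1 n).trans <| by
      have hq : 0 < 1 - q := by linarith
      gcongr ?_ / _
      refine pow_le_pow_of_le_one h0.le h1.le ?_
      rcases n with _ | n
      · simp
      · nlinarith
  have hq2 : q ^ 2 ≤ 1 / 400 := by nlinarith
  have h20 : 0 ≤ q ^ 2 := sq_nonneg q
  have hg := hasSum_pow_natAbs h20 (by linarith : q ^ 2 < 1)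
  have key := tsum_of_norm_bounded
    ((hg.sub (hasSum_ite_eq (0 : ℤ) (1 : ℝ))).mul_left (1 / (1 - q)))
    (f := fun m : ℤ => alternatingTail q m.natAbs
      - if m = 0 then alternatingTail q 0 else 0) (fun m => by
    by_cases hm : m = 0
    · subst hm; simp
    · simp only [hm, if_false, sub_zero, Real.norm_eq_abs]
      refine (hb _).trans_eq ?_
      rw [pow_mul]; ring)
  rw [(hs.hasSum.sub (hasSum_ite_eq (0 : ℤ) (alternatingTail q 0))).tsum_eq, Real.norm_eq_abs]
    at key
  have h3 : 1 / (1 - q) ≤ 20 / 19 := by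
    rw [div_le_div_iff₀ (by linarith) (by norm_num)]; linarith
  have h4 : (1 + q ^ 2) / (1 - q ^ 2) - 1 ≤ 2 / 399 := by
    rw [sub_le_iff_le_add, div_le_iff₀ (by linarith)]; linarith
  have h5 : 0 ≤ (1 + q ^ 2) / (1 - q ^ 2) - 1 := by
    rw [sub_nonneg, le_div_iff₀ (by linarith)]; linarith
  have h6 : 1 / (1 - q) * ((1 + q ^ 2) / (1 - q ^ 2) - 1) ≤ 20 / 19 * (2 / 399) := by
    have : 0 < 1 - q := by linarith
    gcongr
  have h7 : 1 - 1 / 380 ≤ alternatingTail q 0 := by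
    have h8 := hb 1
    rw [alternatingTail_eq_add h0 h1 0]
    have : q ^ (2 * 1) / (1 - q) ≤ 1 / 380 := by
      rw [mul_one, div_le_div_iff₀ (by linarith) (by norm_num)]; nlinarith
    have := (abs_le.1 (h8.trans this)).1
    simp only [pow_zero, zero_mul, mul_one]
    rw [zero_add]
    linarith
  have := (abs_le.1 (key.trans h6)).1
  norm_num at this h7 ⊢
  linarith

/-- The sequence `q ^ (m ^ 2)` has a convolution inverse that decays like `q ^ |m|`. -/
theorem exists_conv_inverse {q : ℝ} (h0 : 0 < q) (hq : q ≤ 1 / 20) :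
    ∃ c : ℤ → ℝ, (∀ m, |c m| ≤ 11 / 10 * q ^ m.natAbs) ∧
      ∀ l : ℤ, ∑' m : ℤ, q ^ ((l - m) ^ 2) * c m = if l = 0 then 1 else 0 := by
  have h1 : q < 1 := by linarith
  set K := ∑' m : ℤ, q ^ ((0 - m) ^ 2) * (q ^ (-m ^ 2) * alternatingTail q m.natAbs)
  have hK : 99 / 100 ≤ K := le_tsum_alternatingTail h0 hq
  have hK0 : 0 < K := by linarith
  refine ⟨fun m => q ^ (-m ^ 2) * alternatingTail q m.natAbs / K, fun m => ?_, fun l => ?_⟩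
  -- Choosing `l = m` reduces the factor `q^{(l-m)²}` to 1 and leaves the coefficient alone.
  · have h := norm_conv_alternatingTail_le h0 h1 m m
    simp only [sub_self, ne_eq, OfNat.ofNat_ne_zero, not_false_eq_true, zero_pow, zpow_zero,
      one_mul, Real.norm_eq_abs] at h
    rw [abs_div, abs_of_pos hK0, div_le_iff₀ hK0]
    refine h.trans ?_
    rw [div_le_iff₀ (by linarith)]
    have hp : 0 < q ^ m.natAbs := pow_pos h0 _
    -- The constant `11/10` is chosen so that `1.1 · 0.99 · 0.95 > 1`.
    have : 1 ≤ 11 / 10 * K * (1 - q) := by nlinarith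
    nlinarith
  · simp_rw [← mul_div_assoc]
    rw [tsum_div_const]
    split_ifs with hl
    · subst hl
      exact div_self hK0.ne'
    · rw [tsum_conv_alternatingTail_eq_zero h0 h1 hl, zero_div]

/-! ### Convolution of absolutely convergent series of powers -/

/-- Absolute convergence allows the double series to be regrouped by `l = j + i`. Applied to the
translations by `√2 * j`, this turns a convolution identity for scalars into an operator identity.
-/
theorem tsum_smul_mul_tsum_smul {A : Type*} [NormedRing A] [NormedAlgebra ℂ A] [CompleteSpace A]
    {u : ℤ → A} (hu : ∀ i j, u i * u j = u (i + j)) (hb : ∀ i, ‖u i‖ ≤ 1) {α c : ℤ → ℂ}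
    (hα : Summable fun j => ‖α j‖) (hc : Summable fun j => ‖c j‖) :
    (∑' j, α j • u j) * (∑' i, c i • u i) = ∑' l, (∑' i, α (l - i) * c i) • u l := by
  have hnorm : ∀ {d : ℤ → ℂ}, (Summable fun j => ‖d j‖) → Summable fun j => ‖d j • u j‖ :=
    fun {d} hd => Summable.of_nonneg_of_le (fun j => norm_nonneg _) (fun j => by
      rw [norm_smul]
      exact mul_le_of_le_one_right (norm_nonneg _) (hb j)) hd
  have hs := summable_mul_of_summable_norm (hnorm hα) (hnorm hc)
  have hs2 := summable_mul_of_summable_norm (f := α) (g := c) hα hc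
  let e : ℤ × ℤ ≃ ℤ × ℤ :=
    { toFun := fun z => (z.1 - z.2, z.2)
      invFun := fun z => (z.1 + z.2, z.2)
      left_inv := fun z => by simp
      right_inv := fun z => by simp }
  rw [tsum_mul_tsum_of_summable_norm (hnorm hα) (hnorm hc), ← e.tsum_eq]
  have hs' := e.summable_iff.2 hs
  have hs2' := e.summable_iff.2 hs2
  have hval : ∀ z : ℤ × ℤ, (α (e z).1 • u (e z).1) * (c (e z).2 • u (e z).2)
      = (α (z.1 - z.2) * c z.2) • u z.1 := by
    intro z
    simp only [e, Equiv.coe_fn_mk, smul_mul_smul_comm, hu, sub_add_cancel]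
  rw [tsum_congr hval]
  rw [Summable.tsum_prod (by simpa only [Function.comp_def, hval] using hs')]
  refine tsum_congr fun l => ?_
  exact (hs2'.prod_factor l).tsum_smul_const (u l)

/-! ### Multiplication and translation operators on `L²(ℝ)` -/

theorem memLp_mul (w : BoundedContinuousFunction ℝ ℂ) (f : L2) :
    MemLp (fun t => w t * f t) 2 volume :=
  (Lp.memLp f).of_le_mul (c := ‖w‖)
    (w.continuous.aestronglyMeasurable.mul (Lp.aestronglyMeasurable f))
    (Filter.Eventually.of_forall fun t => by
      rw [norm_mul]
      exact mul_le_mul_of_nonneg_right (w.norm_coe_le_norm t) (norm_nonneg _))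

/-- Multiplication by a bounded continuous function, as an operator on `L²(ℝ)`. -/
def mulOp (w : BoundedContinuousFunction ℝ ℂ) : L2 →L[ℂ] L2 :=
  LinearMap.mkContinuous
    { toFun := fun f => (memLp_mul w f).toLp _
      map_add' := fun f g => by
        refine Lp.ext ?_
        filter_upwards [(memLp_mul w (f + g)).coeFn_toLp, (memLp_mul w f).coeFn_toLp,
          (memLp_mul w g).coeFn_toLp, Lp.coeFn_add f g,
          Lp.coeFn_add ((memLp_mul w f).toLp _) ((memLp_mul w g).toLp _)] with t h1 h2 h3 h4 h5
        rw [h1, h5, Pi.add_apply, h2, h3, h4, Pi.add_apply, mul_add]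
      map_smul' := fun a f => by
        refine Lp.ext ?_
        filter_upwards [(memLp_mul w (a • f)).coeFn_toLp, (memLp_mul w f).coeFn_toLp,
          Lp.coeFn_smul a f, Lp.coeFn_smul a ((memLp_mul w f).toLp _)] with t h1 h2 h3 h4
        rw [h1, RingHom.id_apply, h4, Pi.smul_apply, h2, h3, Pi.smul_apply, smul_eq_mul,
          smul_eq_mul]
        ring }
    ‖w‖ fun f => by
      refine Lp.norm_le_mul_norm_of_ae_le_mul ?_
      filter_upwards [(memLp_mul w f).coeFn_toLp] with t h1
      simp only [LinearMap.coe_mk, AddHom.coe_mk]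
      rw [h1, norm_mul]
      exact mul_le_mul_of_nonneg_right (w.norm_coe_le_norm t) (norm_nonneg _)

theorem coeFn_mulOp (w : BoundedContinuousFunction ℝ ℂ) (f : L2) :
    mulOp w f =ᵐ[volume] fun t => w t * f t :=
  (memLp_mul w f).coeFn_toLp

theorem norm_mulOp_le (w : BoundedContinuousFunction ℝ ℂ) : ‖mulOp w‖ ≤ ‖w‖ :=
  LinearMap.mkContinuous_norm_le _ (norm_nonneg _) _

/-- Translation `f ↦ f(· - y)` on `L²(ℝ)`. -/
def translation (y : ℝ) : L2 →L[ℂ] L2 :=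
  (Lp.compMeasurePreservingₗᵢ ℂ (fun t : ℝ => t - y)
    (measurePreserving_sub_right volume y)).toContinuousLinearMap

theorem coeFn_translation (y : ℝ) (f : L2) : translation y f =ᵐ[volume] fun t => f (t - y) :=
  Lp.coeFn_compMeasurePreserving f (measurePreserving_sub_right volume y)

theorem norm_translation_le (y : ℝ) : ‖translation y‖ ≤ 1 :=
  LinearIsometry.norm_toContinuousLinearMap_le _

theorem ae_eq_comp_sub {f g : ℝ → ℂ} (h : f =ᵐ[volume] g) (y : ℝ) :
    (fun t => f (t - y)) =ᵐ[volume] fun t => g (t - y) :=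
  (measurePreserving_sub_right volume y).quasiMeasurePreserving.ae_eq_comp h

theorem translation_mul (x y : ℝ) : translation x * translation y = translation (x + y) := by
  ext1 f
  refine Lp.ext ?_
  rw [mul_apply_eq_comp]
  filter_upwards [coeFn_translation x (translation y f),
    ae_eq_comp_sub (coeFn_translation y f) x, coeFn_translation (x + y) f] with t h1 h2 h3
  rw [h1, h2, h3, sub_sub]

theorem translation_zero : translation 0 = 1 := by
  ext1 f
  refine Lp.ext ?_
  filter_upwards [coeFn_translation 0 f] with t h1
  rw [h1, sub_zero, one_apply_eq_self]

theorem mulOp_mul_translation {w : BoundedContinuousFunction ℝ ℂ} {y : ℝ}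
    (hw : ∀ t, w (t - y) = w t) : mulOp w * translation y = translation y * mulOp w := by
  ext1 f
  refine Lp.ext ?_
  rw [mul_apply_eq_comp, mul_apply_eq_comp]
  filter_upwards [coeFn_mulOp w (translation y f), coeFn_translation y f,
    ae_eq_comp_sub (coeFn_mulOp w f) y, coeFn_translation y (mulOp w f)] with t h1 h2 h3 h4
  rw [h1, h2, h4, h3, hw]

theorem mulOp_mul (v w : BoundedContinuousFunction ℝ ℂ) : mulOp v * mulOp w = mulOp (v * w) := by
  ext1 f
  refine Lp.ext ?_
  rw [mul_apply_eq_comp]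
  filter_upwards [coeFn_mulOp v (mulOp w f), coeFn_mulOp w f, coeFn_mulOp (v * w) f]
    with t h1 h2 h3
  rw [h1, h2, h3, BoundedContinuousFunction.mul_apply, mul_assoc]

theorem mulOp_one : mulOp 1 = 1 := by
  ext1 f
  refine Lp.ext ?_
  filter_upwards [coeFn_mulOp 1 f] with t h1
  rw [h1, one_apply_eq_self]
  simp

theorem norm_exp_two_pi (ω t : ℝ) :
    ‖Complex.exp (2 * Real.pi * Complex.I * ω * t)‖ = 1 := by
  rw [show (2 * Real.pi * Complex.I * ω * t : ℂ) = ((2 * Real.pi * ω * t : ℝ) : ℂ) * Complex.I by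
    push_cast; ring, Complex.norm_exp_ofReal_mul_I]

/-- The character `t ↦ e^{2πiωt}`. -/
def character (ω : ℝ) : BoundedContinuousFunction ℝ ℂ :=
  BoundedContinuousFunction.ofNormedAddCommGroup
    (fun t : ℝ => Complex.exp (2 * Real.pi * Complex.I * ω * t)) (by fun_prop) 1
    fun t => (norm_exp_two_pi ω t).le

theorem character_apply (ω t : ℝ) :
    character ω t = Complex.exp (2 * Real.pi * Complex.I * ω * t) := rfl

theorem coeFn_tfShift (p : ℝ × ℝ) (g : L2) :
    tfShift p g =ᵐ[volume]
      fun t => Complex.exp (2 * Real.pi * Complex.I * p.2 * t) * g (t - p.1) :=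
  (memLp_tfShift p g).coeFn_toLp

theorem tfShift_eq (p : ℝ × ℝ) (g : L2) :
    tfShift p g = (mulOp (character p.2) * translation p.1) g := by
  refine Lp.ext ?_
  rw [mul_apply_eq_comp]
  filter_upwards [coeFn_tfShift p g, coeFn_mulOp (character p.2) (translation p.1 g),
    coeFn_translation p.1 g] with t h1 h2 h3
  rw [h1, h2, h3, character_apply]

theorem coeFn_gaussian : gaussian =ᵐ[volume] fun t => (gaussianFun t : ℂ) :=
  memLp_gaussianFun.coeFn_toLp

theorem coeFn_tfShift_gaussian (p : ℝ × ℝ) :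
    tfShift p gaussian =ᵐ[volume]
      fun t => Complex.exp (2 * Real.pi * Complex.I * p.2 * t) * gaussianFun (t - p.1) := by
  filter_upwards [coeFn_tfShift p gaussian, ae_eq_comp_sub coeFn_gaussian p.1] with t h1 h2
  rw [h1, h2]

/-! ### Convergent series in `L²(ℝ)` -/

theorem coeFn_finsetSum {ι : Type*} (u : ι → L2) (s : Finset ι) :
    (∑ i ∈ s, u i : L2) =ᵐ[volume] fun t => ∑ i ∈ s, u i t := by
  classical
  induction s using Finset.induction_on with
  | empty =>
    simp only [Finset.sum_empty]
    exact Lp.coeFn_zero ℂ 2 (volume : Measure ℝ)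
  | insert i s hi ih =>
    rw [Finset.sum_insert hi]
    filter_upwards [Lp.coeFn_add (u i) (∑ i ∈ s, u i), ih] with t h1 h2
    rw [h1, Pi.add_apply, h2, Finset.sum_insert hi]

/-- If a series converges both in `L²` and pointwise almost everywhere, the sums agree. -/
theorem ae_eq_of_hasSum {ι : Type*} [Countable ι] {u : ι → L2} {U : L2} (hU : HasSum u U)
    {v : ℝ → ℂ} (hv : ∀ᵐ t, HasSum (fun i => u i t) (v t)) : U =ᵐ[volume] v := by
  obtain ⟨ns, hns, hae⟩ := (tendstoInMeasure_of_tendsto_Lp hU).exists_seq_tendsto_ae'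
  have hsum : ∀ᵐ t, ∀ n, (∑ i ∈ ns n, u i : L2) t = ∑ i ∈ ns n, u i t :=
    ae_all_iff.2 fun n => coeFn_finsetSum u (ns n)
  filter_upwards [hae, hsum, hv] with t h1 h2 h3
  simp_rw [h2] at h1
  exact tendsto_nhds_unique h1 (h3.comp hns)

/-! ### Bessel families -/

section Bessel

variable {ι : Type*} {H : Type*} [NormedAddCommGroup H] [InnerProductSpace ℂ H]

/-- A family is `B`-Bessel if its finite synthesis operators have norm at most `√B`. -/
def IsBessel (B : ℝ) (e : ι → H) : Prop :=
  ∀ (s : Finset ι) (d : ι → ℂ), ‖∑ i ∈ s, d i • e i‖ ^ 2 ≤ B * ∑ i ∈ s, ‖d i‖ ^ 2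

/-- Schur's test for the Gram matrix of a family. -/
theorem isBessel_of_gram {B : ℝ} {e : ι → H} {m : ι → ι → ℝ} (hm : ∀ i j, m i j = m j i)
    (hm0 : ∀ i j, 0 ≤ m i j)
    (he : ∀ i j, ‖inner ℂ (e i) (e j)‖ ≤ m i j)
    (hB : ∀ (s : Finset ι) (i : ι), ∑ j ∈ s, m i j ≤ B) : IsBessel B e := by
  intro s d
  have h1 : ‖∑ i ∈ s, d i • e i‖ ^ 2 ≤ ∑ i ∈ s, ∑ j ∈ s, ‖d i‖ * ‖d j‖ * m i j := by
    have h0 : ‖∑ i ∈ s, d i • e i‖ ^ 2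
        = ‖inner ℂ (∑ i ∈ s, d i • e i) (∑ i ∈ s, d i • e i)‖ := by
      rw [inner_self_eq_norm_sq_to_K]
      simp
    rw [h0, sum_inner]
    refine (norm_sum_le _ _).trans (Finset.sum_le_sum fun i _ => ?_)
    rw [inner_sum]
    refine (norm_sum_le _ _).trans (Finset.sum_le_sum fun j _ => ?_)
    rw [inner_smul_left, inner_smul_right, norm_mul, norm_mul, RCLike.norm_conj, ← mul_assoc]
    gcongr
    exact he i j
  have h2 : ∀ i j, ‖d i‖ * ‖d j‖ * m i j ≤ (‖d i‖ ^ 2 * m i j + ‖d j‖ ^ 2 * m i j) / 2 := by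
    intro i j
    nlinarith [mul_nonneg (sq_nonneg (‖d i‖ - ‖d j‖)) (hm0 i j)]
  have h3 : ∑ i ∈ s, ∑ j ∈ s, ‖d i‖ ^ 2 * m i j ≤ B * ∑ i ∈ s, ‖d i‖ ^ 2 := by
    rw [Finset.mul_sum]
    refine Finset.sum_le_sum fun i _ => ?_
    rw [← Finset.mul_sum, mul_comm]
    exact mul_le_mul_of_nonneg_right (hB s i) (sq_nonneg _)
  have h4 : ∑ i ∈ s, ∑ j ∈ s, ‖d j‖ ^ 2 * m i j = ∑ i ∈ s, ∑ j ∈ s, ‖d i‖ ^ 2 * m i j := by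
    rw [Finset.sum_comm]
    exact Finset.sum_congr rfl fun i _ => Finset.sum_congr rfl fun j _ => by rw [hm]
  calc _ ≤ _ := h1
    _ ≤ ∑ i ∈ s, ∑ j ∈ s, (‖d i‖ ^ 2 * m i j + ‖d j‖ ^ 2 * m i j) / 2 :=
        Finset.sum_le_sum fun i _ => Finset.sum_le_sum fun j _ => h2 i j
    _ = ∑ i ∈ s, ∑ j ∈ s, ‖d i‖ ^ 2 * m i j := by
        simp_rw [← Finset.sum_div, Finset.sum_add_distrib]
        rw [h4]; ring
    _ ≤ _ := h3

namespace IsBessel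

variable {B : ℝ} {e : ι → H}

/-- Duality between synthesis and analysis: with `X` the left side, Cauchy–Schwarz gives `X ≤ √(B X)
‖f‖`, and one factor `√X` cancels. -/
theorem sum_sq_inner_le (he : IsBessel B e) (hB : 0 ≤ B) (s : Finset ι) (f : H) :
    ∑ i ∈ s, ‖inner ℂ (e i) f‖ ^ 2 ≤ B * ‖f‖ ^ 2 := by
  set X := ∑ i ∈ s, ‖inner ℂ (e i) f‖ ^ 2 with hX
  have hX0 : 0 ≤ X := Finset.sum_nonneg fun i _ => sq_nonneg _
  have h1 : ‖∑ i ∈ s, inner ℂ (e i) f • e i‖ ^ 2 ≤ B * X := he s _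
  have h2 : inner ℂ (∑ i ∈ s, inner ℂ (e i) f • e i) f = (X : ℂ) := by
    rw [sum_inner, hX]
    push_cast
    refine Finset.sum_congr rfl fun i _ => ?_
    rw [inner_smul_left, Complex.conj_mul']
  have h3 : X ≤ ‖∑ i ∈ s, inner ℂ (e i) f • e i‖ * ‖f‖ := by
    have := norm_inner_le_norm (𝕜 := ℂ) (∑ i ∈ s, inner ℂ (e i) f • e i) f
    rwa [h2, Complex.norm_real, Real.norm_of_nonneg hX0] at this
  by_cases hX1 : X = 0
  · rw [hX1]; positivity
  have hXp : 0 < X := lt_of_le_of_ne hX0 (Ne.symm hX1)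
  have h4 : X * X ≤ B * ‖f‖ ^ 2 * X := by
    calc X * X ≤ (‖∑ i ∈ s, inner ℂ (e i) f • e i‖ * ‖f‖)
          * (‖∑ i ∈ s, inner ℂ (e i) f • e i‖ * ‖f‖) := mul_le_mul h3 h3 hX0 (by positivity)
      _ = ‖∑ i ∈ s, inner ℂ (e i) f • e i‖ ^ 2 * ‖f‖ ^ 2 := by ring
      _ ≤ B * X * ‖f‖ ^ 2 := by gcongr
      _ = _ := by ring
  exact le_of_mul_le_mul_right h4 hXp

theorem summable_sq_inner (he : IsBessel B e) (hB : 0 ≤ B) (f : H) :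
    Summable fun i => ‖inner ℂ (e i) f‖ ^ 2 :=
  summable_of_sum_le (fun _ => sq_nonneg _) (fun s => he.sum_sq_inner_le hB s f)

theorem tsum_sq_inner_le (he : IsBessel B e) (hB : 0 ≤ B) (f : H) :
    ∑' i, ‖inner ℂ (e i) f‖ ^ 2 ≤ B * ‖f‖ ^ 2 :=
  (he.summable_sq_inner hB f).tsum_le_of_sum_le (fun s => he.sum_sq_inner_le hB s f)

theorem summable_smul [CompleteSpace H] (he : IsBessel B e) (hB : 0 ≤ B) {d : ι → ℂ}
    (hd : Summable fun i => ‖d i‖ ^ 2) : Summable fun i => d i • e i := by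
  rw [summable_iff_vanishing_norm]
  intro ε hε
  obtain ⟨s, hs⟩ := summable_iff_vanishing_norm.1 hd (ε ^ 2 / (B + 1)) (by positivity)
  refine ⟨s, fun t ht => ?_⟩
  have h1 := hs t ht
  rw [Real.norm_of_nonneg (Finset.sum_nonneg fun i _ => sq_nonneg _),
    lt_div_iff₀ (by linarith)] at h1
  have h2 : 0 ≤ ∑ i ∈ t, ‖d i‖ ^ 2 := Finset.sum_nonneg fun i _ => sq_nonneg _
  refine lt_of_pow_lt_pow_left₀ 2 hε.le ((he t d).trans_lt ?_)
  nlinarith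

theorem norm_tsum_sq_le [CompleteSpace H] (he : IsBessel B e) (hB : 0 ≤ B) {d : ι → ℂ}
    (hd : Summable fun i => ‖d i‖ ^ 2) : ‖∑' i, d i • e i‖ ^ 2 ≤ B * ∑' i, ‖d i‖ ^ 2 :=
  le_of_tendsto' ((he.summable_smul hB hd).hasSum.norm.pow 2) fun s =>
    (he s d).trans (mul_le_mul_of_nonneg_left (hd.sum_le_tsum s fun _ _ => sq_nonneg _) hB)

theorem summable_inner_smul [CompleteSpace H] (he : IsBessel B e) (hB : 0 ≤ B) (f : H) :
    Summable fun i => inner ℂ (e i) f • e i :=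
  he.summable_smul hB (he.summable_sq_inner hB f)

end IsBessel

end Bessel

/-- Needed to extend by density an identity checked on test functions. -/
theorem IsBessel.continuous_frameOperator {ι : Type} {B : ℝ} {e : ι → L2} (he : IsBessel B e)
    (hB : 0 ≤ B) : Continuous (frameOperator e) := by
  let S : L2 →ₗ[ℂ] L2 :=
    { toFun := frameOperator e
      map_add' := fun f g => by
        simp only [frameOperator, inner_add_right, add_smul]
        exact (he.summable_inner_smul hB f).tsum_add (he.summable_inner_smul hB g)
      map_smul' := fun a f => by
        simp only [frameOperator, inner_smul_right, mul_smul, RingHom.id_apply]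
        exact (he.summable_inner_smul hB f).tsum_const_smul a }
  refine (S.mkContinuous B fun f => ?_).continuous
  refine le_of_pow_le_pow_left₀ two_ne_zero (by positivity) ?_
  refine (he.norm_tsum_sq_le hB (he.summable_sq_inner hB f)).trans ?_
  calc _ ≤ B * (B * ‖f‖ ^ 2) := mul_le_mul_of_nonneg_left (he.tsum_sq_inner_le hB f) hB
    _ = _ := by ring

/-! ### Gaussian integrals and the Gram matrix of the Gabor system -/

/-- Only the modulus is recorded: the centre `x` enters through a phase alone, which Schur's test
ignores. -/
theorem norm_integral_gaussian_mul_character {s : ℝ} (hs : 0 < s) (x Δ : ℝ) :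
    ‖∫ t : ℝ, Complex.exp (2 * Real.pi * Complex.I * Δ * t) *
        (Real.exp (-Real.pi * s * (t - x) ^ 2) : ℂ)‖ =
      (√s)⁻¹ * Real.exp (-Real.pi * s⁻¹ * Δ ^ 2) := by
  have hb : ((-Real.pi * s : ℝ) : ℂ).re < 0 := by
    rw [Complex.ofReal_re]
    have := mul_pos Real.pi_pos hs
    linarith
  have h := integral_cexp_quadratic hb (2 * Real.pi * s * x + 2 * Real.pi * Complex.I * Δ)
    (-Real.pi * s * x ^ 2)
  have e : ∀ t : ℝ, Complex.exp (2 * Real.pi * Complex.I * Δ * t) *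
        (Real.exp (-Real.pi * s * (t - x) ^ 2) : ℂ) =
      Complex.exp (((-Real.pi * s : ℝ) : ℂ) * t ^ 2 +
        (2 * Real.pi * s * x + 2 * Real.pi * Complex.I * Δ) * t + -Real.pi * s * x ^ 2) := by
    intro t
    rw [Complex.ofReal_exp, ← Complex.exp_add]
    congr 1
    push_cast
    ring
  simp_rw [e]
  rw [h, norm_mul]
  have hπ := Real.pi_pos
  congr 1
  · rw [show (Real.pi : ℂ) / -((-Real.pi * s : ℝ) : ℂ) = ((s⁻¹ : ℝ) : ℂ) by
      push_cast
      field_simp, show (1 / 2 : ℂ) = ((1 / 2 : ℝ) : ℂ) by norm_num,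
      ← Complex.ofReal_cpow (inv_nonneg.2 hs.le), Complex.norm_real,
      ← Real.sqrt_eq_rpow, Real.sqrt_inv, Real.norm_of_nonneg (by positivity)]
  · rw [Complex.norm_exp]
    congr 1
    have : (-Real.pi * s * x ^ 2 - (2 * Real.pi * s * x + 2 * Real.pi * Complex.I * Δ) ^ 2 /
        (4 * ((-Real.pi * s : ℝ) : ℂ)) : ℂ) = ((-Real.pi * s⁻¹ * Δ ^ 2 : ℝ) : ℂ) +
          ((2 * Real.pi * x * Δ : ℝ) : ℂ) * Complex.I := by
      have hsC : (s : ℂ) ≠ 0 := by exact_mod_cast hs.ne'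
      have hpC : (Real.pi : ℂ) ≠ 0 := by exact_mod_cast hπ.ne'
      push_cast
      field_simp
      ring_nf
      rw [Complex.I_sq]
      ring
    rw [this, Complex.add_re, Complex.ofReal_re, Complex.re_ofReal_mul, Complex.I_re]
    ring

theorem gaussianFun_pos (t : ℝ) : 0 < gaussianFun t := by
  unfold gaussianFun
  positivity

theorem gaussianFun_mul_gaussianFun (x y t : ℝ) :
    gaussianFun (t - x) * gaussianFun (t - y) =
      √2 * Real.exp (-Real.pi / 2 * (x - y) ^ 2)
        * Real.exp (-Real.pi * 2 * (t - (x + y) / 2) ^ 2) := by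
  have h : (2 : ℝ) ^ (1 / 4 : ℝ) * (2 : ℝ) ^ (1 / 4 : ℝ) = √2 := by
    rw [← Real.rpow_add two_pos, Real.sqrt_eq_rpow]
    norm_num
  unfold gaussianFun
  rw [mul_mul_mul_comm, h, mul_assoc, ← Real.exp_add, ← Real.exp_add]
  congr 2
  ring

theorem norm_inner_tfShift_gaussian (p r : ℝ × ℝ) :
    ‖inner ℂ (tfShift p gaussian) (tfShift r gaussian)‖ =
      Real.exp (-Real.pi / 2 * (p.1 - r.1) ^ 2) * Real.exp (-Real.pi / 2 * (p.2 - r.2) ^ 2) := by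
  rw [L2.inner_def]
  have e : (fun t => inner ℂ (tfShift p gaussian t) (tfShift r gaussian t)) =ᵐ[volume]
      fun t => ((√2 * Real.exp (-Real.pi / 2 * (p.1 - r.1) ^ 2) : ℝ) : ℂ) *
        (Complex.exp (2 * Real.pi * Complex.I * ((r.2 - p.2 : ℝ) : ℂ) * t) *
          (Real.exp (-Real.pi * 2 * (t - (p.1 + r.1) / 2) ^ 2) : ℂ)) := by
    filter_upwards [coeFn_tfShift_gaussian p, coeFn_tfShift_gaussian r] with t h1 h2
    have h3 : Complex.exp (2 * Real.pi * Complex.I * ((r.2 - p.2 : ℝ) : ℂ) * t) =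
        Complex.exp (2 * Real.pi * Complex.I * r.2 * t) *
          (starRingEnd ℂ) (Complex.exp (2 * Real.pi * Complex.I * p.2 * t)) := by
      rw [← Complex.exp_conj, ← Complex.exp_add]
      congr 1
      simp only [map_mul, Complex.conj_ofReal, Complex.conj_I, map_ofNat]
      push_cast
      ring
    rw [h1, h2, RCLike.inner_apply, h3, map_mul, Complex.conj_ofReal]
    have h4 := congrArg (fun r : ℝ => (r : ℂ)) (gaussianFun_mul_gaussianFun p.1 r.1 t)
    simp only [Complex.ofReal_mul] at h4
    rw [Complex.ofReal_mul]
    linear_combination (Complex.exp (2 * Real.pi * Complex.I * r.2 * t) *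
          (starRingEnd ℂ) (Complex.exp (2 * Real.pi * Complex.I * p.2 * t))) * h4
  rw [integral_congr_ae e, integral_const_mul, norm_mul,
    norm_integral_gaussian_mul_character two_pos, Complex.norm_real,
    Real.norm_of_nonneg (by positivity)]
  have h5 : √2 ≠ 0 := by positivity
  have h6 : -Real.pi * 2⁻¹ * (r.2 - p.2) ^ 2 = -Real.pi / 2 * (p.2 - r.2) ^ 2 := by ring
  rw [h6]
  field_simp

theorem mesh_pos : 0 < mesh := by
  unfold mesh
  positivity

theorem mesh_sq : mesh ^ 2 = 1 / 2 := by
  unfold mesh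
  rw [div_pow, Real.sq_sqrt zero_le_two, one_pow]

theorem mesh_mul_sqrt_two : mesh * √2 = 1 := by
  unfold mesh
  field_simp

/-- The Gaussian Gabor system indexed by `ℤ²`. -/
def gaborAtom (z : ℤ × ℤ) : L2 := tfShift (mesh * z.1, mesh * z.2) gaussian

theorem norm_inner_gaborAtom (z w : ℤ × ℤ) :
    ‖inner ℂ (gaborAtom z) (gaborAtom w)‖ =
      Real.exp (-Real.pi * (1 / 4) * ((z.1 : ℝ) - w.1) ^ 2) *
        Real.exp (-Real.pi * (1 / 4) * ((z.2 : ℝ) - w.2) ^ 2) := by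
  rw [gaborAtom, gaborAtom, norm_inner_tfShift_gaussian]
  simp only [← mul_sub, mul_pow, mesh_sq]
  congr 2 <;> ring

theorem exp_neg_pi_le : Real.exp (-Real.pi) ≤ 1 / 20 := by
  rw [Real.exp_neg, ← one_div]
  apply one_div_le_one_div_of_le (by norm_num)
  have h1 : (2.7 : ℝ) ≤ Real.exp 1 := by
    have := Real.exp_one_gt_d9
    linarith
  have h2 : Real.exp 3 = Real.exp 1 ^ 3 := by
    rw [← Real.exp_nat_mul]
    norm_num
  have h3 : Real.exp 3.14 ≤ Real.exp Real.pi := Real.exp_le_exp.2 Real.pi_gt_d2.le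
  have h4 : Real.exp 3.14 = Real.exp 3 * Real.exp 0.14 := by
    rw [← Real.exp_add]
    norm_num
  have h5 : (1.14 : ℝ) ≤ Real.exp 0.14 := by
    have := Real.add_one_le_exp (0.14 : ℝ)
    linarith
  have h6 : (2.7 : ℝ) ^ 3 ≤ Real.exp 1 ^ 3 := by gcongr
  rw [h4, h2] at h3
  nlinarith

theorem periodizedGaussian_quarter_le (t : ℝ) : periodizedGaussian (1 / 4) t ≤ 201 / 100 := by
  have h := (abs_le.1 (abs_sqrt_mul_periodizedGaussian_sub_one_le
    (by norm_num : (0 : ℝ) < 1 / 4) t)).2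
  have hs : √(1 / 4 : ℝ) = 1 / 2 := by
    rw [show (1 / 4 : ℝ) = (1 / 2) ^ 2 by norm_num, Real.sqrt_sq (by norm_num)]
  have hρ : Real.exp (-Real.pi * (1 / 4)⁻¹) ≤ 1 / 1000 := by
    have : Real.exp (-Real.pi * (1 / 4)⁻¹) = Real.exp (-Real.pi) ^ 4 := by
      rw [← Real.exp_nat_mul]
      congr 1
      push_cast
      ring
    rw [this]
    calc _ ≤ (1 / 20 : ℝ) ^ 4 := by gcongr; exact exp_neg_pi_le
      _ ≤ _ := by norm_num
  have h2 : 2 * Real.exp (-Real.pi * (1 / 4)⁻¹) / (1 - Real.exp (-Real.pi * (1 / 4)⁻¹))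
      ≤ 1 / 400 := by
    rw [div_le_iff₀ (by linarith)]
    linarith
  rw [hs] at h
  linarith

theorem periodizedGaussian_half_le (t : ℝ) : periodizedGaussian (1 / 2) t ≤ 143 / 100 := by
  have h := (abs_le.1 (abs_sqrt_mul_periodizedGaussian_sub_one_le
    (by norm_num : (0 : ℝ) < 1 / 2) t)).2
  have hs : (707 / 1000 : ℝ) ≤ √(1 / 2 : ℝ) := Real.le_sqrt_of_sq_le (by norm_num)
  have hρ : Real.exp (-Real.pi * (1 / 2)⁻¹) ≤ 1 / 400 := by
    have : Real.exp (-Real.pi * (1 / 2)⁻¹) = Real.exp (-Real.pi) ^ 2 := by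
      rw [← Real.exp_nat_mul]
      congr 1
      push_cast
      ring
    rw [this]
    calc _ ≤ (1 / 20 : ℝ) ^ 2 := by gcongr; exact exp_neg_pi_le
      _ ≤ _ := by norm_num
  have h2 : 2 * Real.exp (-Real.pi * (1 / 2)⁻¹) / (1 - Real.exp (-Real.pi * (1 / 2)⁻¹))
      ≤ 2 / 399 := by
    rw [div_le_iff₀ (by linarith)]
    linarith
  have h0 : 0 ≤ periodizedGaussian (1 / 2) t := tsum_nonneg fun _ => (Real.exp_pos _).le
  nlinarith

theorem abs_periodizedGaussian_one_sub_one_le (t : ℝ) :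
    |periodizedGaussian 1 t - 1| ≤ 2 / 19 := by
  have h := abs_sqrt_mul_periodizedGaussian_sub_one_le one_pos t
  rw [Real.sqrt_one, one_mul, inv_one, mul_one] at h
  refine h.trans ?_
  have := exp_neg_pi_le
  rw [div_le_iff₀ (by linarith)]
  linarith

theorem sum_exp_le_periodizedGaussian {s : ℝ} (hs : 0 < s) (t : ℝ) (F : Finset ℤ) :
    ∑ k ∈ F, Real.exp (-Real.pi * s * (t - k) ^ 2) ≤ periodizedGaussian s t :=
  (summable_exp_neg_pi_mul_sq hs t).sum_le_tsum F fun _ _ => (Real.exp_pos _).le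

/-- The Gram matrix is, in modulus, a product of two one-dimensional Gaussians, so each row sum is
at most a product of two periodized Gaussians. -/
theorem isBessel_gaborAtom : IsBessel ((201 / 100) ^ 2) gaborAtom := by
  classical
  refine isBessel_of_gram (m := fun z w => ‖inner ℂ (gaborAtom z) (gaborAtom w)‖)
    (fun z w => norm_inner_symm _ _) (fun _ _ => norm_nonneg _) (fun _ _ => le_rfl)
    fun s z => ?_
  simp_rw [norm_inner_gaborAtom]
  have hsub : s ⊆ s.image Prod.fst ×ˢ s.image Prod.snd := fun w hw =>
    Finset.mem_product.2 ⟨Finset.mem_image_of_mem _ hw, Finset.mem_image_of_mem _ hw⟩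
  refine (Finset.sum_le_sum_of_subset_of_nonneg hsub fun _ _ _ => by positivity).trans ?_
  rw [Finset.sum_product]
  dsimp only
  rw [← Finset.sum_mul_sum, sq]
  have h : ∀ (t : ℝ) (F : Finset ℤ),
      ∑ k ∈ F, Real.exp (-Real.pi * (1 / 4) * (t - k) ^ 2) ≤ 201 / 100 := fun t F =>
    (sum_exp_le_periodizedGaussian (by norm_num) t F).trans (periodizedGaussian_quarter_le t)
  exact mul_le_mul (h _ _) (h _ _) (Finset.sum_nonneg fun _ _ => (Real.exp_pos _).le)
    (by norm_num)

/-! ### The inverse of the frame operator -/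

/-- On the dual side the terms are bounded uniformly in `t`, so the Weierstrass test applies
directly. -/
theorem continuous_periodizedGaussian_one : Continuous (periodizedGaussian 1) := by
  have h : Continuous fun t : ℝ => ∑' n : ℤ,
      Complex.exp (-Real.pi / (1 : ℝ) * n ^ 2 + 2 * Real.pi * (Complex.I * t) * n) := by
    refine continuous_tsum (u := fun n : ℤ => Real.exp (-Real.pi * 1 * ((0 : ℝ) - n) ^ 2))
      (fun n => by fun_prop) (summable_exp_neg_pi_mul_sq one_pos 0) fun n t => ?_
    rw [show (-Real.pi / (1 : ℝ) * n ^ 2 + 2 * Real.pi * (Complex.I * t) * n : ℂ) =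
      ((-Real.pi * 1 * ((0 : ℝ) - n) ^ 2 : ℝ) : ℂ) + ((2 * Real.pi * t * n : ℝ) : ℂ) * Complex.I by
        push_cast; ring, Complex.exp_add, norm_mul,
      Complex.norm_exp_ofReal_mul_I, mul_one, ← Complex.ofReal_exp, Complex.norm_real,
      Real.norm_of_nonneg (Real.exp_pos _).le]
  simp_rw [← sqrt_mul_periodizedGaussian one_pos, Real.sqrt_one, one_mul] at h
  exact Complex.continuous_re.comp h

theorem periodizedGaussian_sub_int (s t : ℝ) (n : ℤ) :
    periodizedGaussian s (t - n) = periodizedGaussian s t := by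
  have h := (Equiv.addRight n).tsum_eq fun k : ℤ => Real.exp (-Real.pi * s * (t - k) ^ 2)
  rw [periodizedGaussian, periodizedGaussian, ← h]
  refine tsum_congr fun k => ?_
  simp only [Equiv.coe_addRight]
  push_cast
  congr 2
  ring

theorem le_periodizedGaussian_one (t : ℝ) : 17 / 19 ≤ periodizedGaussian 1 t := by
  have := (abs_le.1 (abs_periodizedGaussian_one_sub_one_le t)).1
  linarith

theorem periodizedGaussian_one_le (t : ℝ) : periodizedGaussian 1 t ≤ 21 / 19 := by
  have := (abs_le.1 (abs_periodizedGaussian_one_sub_one_le t)).2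
  linarith

/-- The multiplier in the factorization of the frame operator. -/
def weight : BoundedContinuousFunction ℝ ℂ :=
  BoundedContinuousFunction.ofNormedAddCommGroup
    (fun t : ℝ => ((2 * periodizedGaussian 1 (√2 * t) : ℝ) : ℂ))
    (by
      have := continuous_periodizedGaussian_one
      fun_prop)
    (42 / 19) fun t => by
      have h1 := le_periodizedGaussian_one (√2 * t)
      have h2 := periodizedGaussian_one_le (√2 * t)
      rw [Complex.norm_real, Real.norm_of_nonneg (by linarith)]
      linarith

theorem weight_apply (t : ℝ) : weight t = ((2 * periodizedGaussian 1 (√2 * t) : ℝ) : ℂ) := rfl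

theorem norm_weight_inv_le (t : ℝ) : ‖(weight t)⁻¹‖ ≤ 19 / 34 := by
  have h1 := le_periodizedGaussian_one (√2 * t)
  rw [weight_apply, norm_inv, Complex.norm_real, Real.norm_of_nonneg (by linarith),
    inv_le_comm₀ (by linarith) (by norm_num)]
  linarith

theorem weight_ne_zero (t : ℝ) : weight t ≠ 0 := by
  have h1 := le_periodizedGaussian_one (√2 * t)
  rw [weight_apply, Complex.ofReal_ne_zero]
  linarith

/-- The pointwise inverse of `weight`. -/
def weightInv : BoundedContinuousFunction ℝ ℂ :=
  BoundedContinuousFunction.ofNormedAddCommGroup (fun t : ℝ => (weight t)⁻¹)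
    (weight.continuous.inv₀ weight_ne_zero) (19 / 34) norm_weight_inv_le

theorem weightInv_apply (t : ℝ) : weightInv t = (weight t)⁻¹ := rfl

theorem norm_weightInv_le : ‖weightInv‖ ≤ 19 / 34 :=
  BoundedContinuousFunction.norm_ofNormedAddCommGroup_le _ (by norm_num) _

theorem weight_mul_weightInv : weight * weightInv = 1 := by
  ext1 t
  simp [weightInv_apply, weight_ne_zero t]

theorem weight_sub_mesh_mul (t : ℝ) (k : ℤ) : weight (t - mesh * k) = weight t := by
  have : √2 * (t - mesh * k) = √2 * t - k := by
    linear_combination (-(k : ℝ)) * mesh_mul_sqrt_two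
  rw [weight_apply, weight_apply, this, periodizedGaussian_sub_int]

/-- Here `√2` is two periods. This makes the multiplication and convolution factors of the frame
operator commute. -/
theorem weight_sub_sqrt_two_mul (t : ℝ) (j : ℤ) : weight (t - √2 * j) = weight t := by
  have h2 : √2 * √2 = 2 := Real.mul_self_sqrt zero_le_two
  have : √2 * (t - √2 * j) = √2 * t - ((2 * j : ℤ) : ℝ) := by
    push_cast
    linear_combination (-(j : ℝ)) * h2
  rw [weight_apply, weight_apply, this, periodizedGaussian_sub_int]

/-- The operator `∑ⱼ α(j) T_{√2 j}`. -/
def shiftSeries (α : ℤ → ℝ) : L2 →L[ℂ] L2 := ∑' j : ℤ, (α j : ℂ) • translation (√2 * j)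

theorem summable_norm_shiftSeries {α : ℤ → ℝ} (hα : Summable fun j => |α j|) :
    Summable fun j : ℤ => ‖(α j : ℂ) • translation (√2 * j)‖ :=
  Summable.of_nonneg_of_le (fun j => norm_nonneg _) (fun j => by
    rw [norm_smul, Complex.norm_real]
    exact mul_le_of_le_one_right (norm_nonneg _) (norm_translation_le _)) hα

theorem norm_shiftSeries_le {α : ℤ → ℝ} {C : ℝ} (hα : HasSum (fun j => |α j|) C) :
    ‖shiftSeries α‖ ≤ C :=
  tsum_of_norm_bounded hα fun j => by
    rw [norm_smul, Complex.norm_real]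
    exact mul_le_of_le_one_right (norm_nonneg _) (norm_translation_le _)

theorem hasSum_shiftSeries {α : ℤ → ℝ} (hα : Summable fun j => |α j|) (f : L2) :
    HasSum (fun j : ℤ => (α j : ℂ) • translation (√2 * j) f) (shiftSeries α f) :=
  (summable_norm_shiftSeries hα).of_norm.hasSum.map
    (⟨⟨fun X => X f, rfl⟩, fun _ _ => rfl⟩ : (L2 →L[ℂ] L2) →+ L2)
    (ContinuousLinearMap.apply ℂ L2 f).continuous

theorem commute_shiftSeries {α : ℤ → ℝ} (hα : Summable fun j => |α j|) {X : L2 →L[ℂ] L2}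
    (hX : ∀ j : ℤ, Commute X (translation (√2 * j))) : Commute X (shiftSeries α) := by
  have hs := (summable_norm_shiftSeries hα).of_norm
  unfold shiftSeries
  rw [Commute, SemiconjBy, ← hs.tsum_mul_left, ← hs.tsum_mul_right]
  exact tsum_congr fun j => ((hX j).smul_right _).eq

theorem shiftSeries_mul_shiftSeries {α c : ℤ → ℝ} (hα : Summable fun j => |α j|)
    (hc : Summable fun j => |c j|) (hαc : ∀ l, ∑' i, α (l - i) * c i = if l = 0 then 1 else 0) :
    shiftSeries α * shiftSeries c = 1 := by
  have h := tsum_smul_mul_tsum_smul (A := L2 →L[ℂ] L2) (u := fun j : ℤ => translation (√2 * j))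
    (α := fun j => (α j : ℂ)) (c := fun j => (c j : ℂ))
    (fun i j => by
      rw [translation_mul]
      push_cast
      rw [mul_add]) (fun j => norm_translation_le _)
    (by simpa using hα) (by simpa using hc)
  unfold shiftSeries
  rw [h]
  have e : ∀ l : ℤ, (∑' i, (α (l - i) : ℂ) * (c i : ℂ)) = if l = 0 then 1 else 0 := by
    intro l
    have := congrArg (fun r : ℝ => (r : ℂ)) (hαc l)
    push_cast at this
    rw [this]
    split_ifs <;> simp
  simp_rw [e]
  rw [tsum_eq_single 0 (fun l hl => by simp [hl])]
  simp [translation_zero]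

/-- The Fourier coefficients of the theta function, `θ(j) = e^{-πj²}`. -/
def thetaCoeff (j : ℤ) : ℝ := Real.exp (-Real.pi) ^ (j ^ 2)

theorem exists_thetaInvCoeff : ∃ c : ℤ → ℝ,
    (∀ m, |c m| ≤ 11 / 10 * Real.exp (-Real.pi) ^ m.natAbs) ∧
      ∀ l : ℤ, ∑' m : ℤ, thetaCoeff (l - m) * c m = if l = 0 then 1 else 0 :=
  exists_conv_inverse (Real.exp_pos _) exp_neg_pi_le

/-- The convolution inverse of `thetaCoeff`. -/
def thetaInvCoeff : ℤ → ℝ := exists_thetaInvCoeff.choose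

theorem abs_thetaInvCoeff_le (m : ℤ) :
    |thetaInvCoeff m| ≤ 11 / 10 * Real.exp (-Real.pi) ^ m.natAbs :=
  exists_thetaInvCoeff.choose_spec.1 m

theorem thetaCoeff_conv_thetaInvCoeff (l : ℤ) :
    ∑' m : ℤ, thetaCoeff (l - m) * thetaInvCoeff m = if l = 0 then 1 else 0 :=
  exists_thetaInvCoeff.choose_spec.2 l

theorem thetaInvCoeff_conv_thetaCoeff (l : ℤ) :
    ∑' m : ℤ, thetaInvCoeff (l - m) * thetaCoeff m = if l = 0 then 1 else 0 := by
  rw [← thetaCoeff_conv_thetaInvCoeff l, ← (Equiv.subLeft l).tsum_eq]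
  exact tsum_congr fun m => by simp [mul_comm]

theorem thetaCoeff_eq (j : ℤ) : thetaCoeff j = Real.exp (-Real.pi * (j : ℝ) ^ 2) := by
  rw [thetaCoeff, Real.exp_mul, ← Real.rpow_intCast]
  push_cast
  rfl

theorem summable_abs_thetaCoeff : Summable fun j => |thetaCoeff j| := by
  simp_rw [thetaCoeff_eq, abs_of_pos (Real.exp_pos _)]
  simpa using summable_exp_neg_pi_mul_sq one_pos 0

theorem hasSum_thetaInvCoeff_bound :
    HasSum (fun m : ℤ => 11 / 10 * Real.exp (-Real.pi) ^ m.natAbs)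
      (11 / 10 * ((1 + Real.exp (-Real.pi)) / (1 - Real.exp (-Real.pi)))) :=
  (hasSum_pow_natAbs (Real.exp_pos _).le (by linarith [exp_neg_pi_le])).mul_left _

theorem summable_abs_thetaInvCoeff : Summable fun j => |thetaInvCoeff j| :=
  Summable.of_nonneg_of_le (fun _ => abs_nonneg _) abs_thetaInvCoeff_le
    hasSum_thetaInvCoeff_bound.summable

/-- The inverse of the Gabor frame operator. -/
def frameInv : L2 →L[ℂ] L2 := mulOp weightInv * shiftSeries thetaInvCoeff

/-- The `ℓ¹` norm of the coefficients bounds the convolution by `1.1 · 21/19 ≤ 1.22`, and the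
multiplier contributes `19/34`. -/
theorem norm_frameInv_le : ‖frameInv‖ ≤ 7 / 10 := by
  have h1 : ‖shiftSeries thetaInvCoeff‖ ≤ 61 / 50 := by
    refine (norm_shiftSeries_le summable_abs_thetaInvCoeff.hasSum).trans ?_
    refine (summable_abs_thetaInvCoeff.tsum_le_tsum abs_thetaInvCoeff_le
      hasSum_thetaInvCoeff_bound.summable).trans ?_
    rw [hasSum_thetaInvCoeff_bound.tsum_eq]
    have h := exp_neg_pi_le
    have : (1 + Real.exp (-Real.pi)) / (1 - Real.exp (-Real.pi)) ≤ 21 / 19 := by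
      rw [div_le_div_iff₀ (by linarith) (by norm_num)]
      linarith
    linarith
  refine (norm_mul_le _ _).trans ?_
  refine (mul_le_mul ((norm_mulOp_le _).trans norm_weightInv_le) h1 (norm_nonneg _)
    (by norm_num)).trans ?_
  norm_num

theorem commute_mulOp_translation {w : BoundedContinuousFunction ℝ ℂ} {y : ℝ}
    (hw : ∀ t, w (t - y) = w t) : Commute (mulOp w) (translation y) :=
  mulOp_mul_translation hw

theorem commute_translation (x y : ℝ) : Commute (translation x) (translation y) := by
  rw [Commute, SemiconjBy, translation_mul, translation_mul, add_comm]

theorem commute_mulOp (v w : BoundedContinuousFunction ℝ ℂ) : Commute (mulOp v) (mulOp w) := by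
  rw [Commute, SemiconjBy, mulOp_mul, mulOp_mul, mul_comm]

/-- The factorized form of the Gabor frame operator. -/
def frameFactorization : L2 →L[ℂ] L2 := mulOp weight * shiftSeries thetaCoeff

theorem weightInv_sub_sqrt_two_mul (t : ℝ) (j : ℤ) :
    weightInv (t - √2 * j) = weightInv t := by
  rw [weightInv_apply, weightInv_apply, weight_sub_sqrt_two_mul]

theorem frameFactorization_mul_frameInv : frameFactorization * frameInv = 1 := by
  have h : Commute (mulOp weightInv) (shiftSeries thetaCoeff) :=
    commute_shiftSeries summable_abs_thetaCoeff fun j =>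
      commute_mulOp_translation fun t => weightInv_sub_sqrt_two_mul t j
  unfold frameFactorization frameInv
  rw [mul_assoc, ← mul_assoc (shiftSeries thetaCoeff), ← h.eq, mul_assoc,
    shiftSeries_mul_shiftSeries summable_abs_thetaCoeff summable_abs_thetaInvCoeff
      thetaCoeff_conv_thetaInvCoeff, mul_one, mulOp_mul, weight_mul_weightInv, mulOp_one]

theorem frameInv_mul_frameFactorization : frameInv * frameFactorization = 1 := by
  have h : Commute (mulOp weight) (shiftSeries thetaInvCoeff) :=
    commute_shiftSeries summable_abs_thetaInvCoeff fun j =>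
      commute_mulOp_translation fun t => weight_sub_sqrt_two_mul t j
  unfold frameFactorization frameInv
  rw [mul_assoc, ← mul_assoc (shiftSeries thetaInvCoeff), ← h.eq, mul_assoc,
    shiftSeries_mul_shiftSeries summable_abs_thetaInvCoeff summable_abs_thetaCoeff
      thetaInvCoeff_conv_thetaCoeff, mul_one, mulOp_mul, mul_comm, weight_mul_weightInv, mulOp_one]

/-- Since `mesh * √2 = 1`, the shift changes the phase by `l * j` full turns. -/
theorem character_sub_sqrt_two_mul (t : ℝ) (l j : ℤ) :
    character (mesh * l) (t - √2 * j) = character (mesh * l) t := by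
  have h := congrArg (fun r : ℝ => (r : ℂ)) mesh_mul_sqrt_two
  push_cast at h
  rw [character_apply, character_apply]
  have e : (2 * Real.pi * Complex.I * ((mesh * l : ℝ) : ℂ) * ((t - √2 * j : ℝ) : ℂ) : ℂ) =
      2 * Real.pi * Complex.I * ((mesh * l : ℝ) : ℂ) * t
        - ((l * j : ℤ) : ℂ) * (2 * Real.pi * Complex.I) := by
    push_cast
    linear_combination (-(2 * Real.pi * Complex.I * l * j)) * h
  rw [e, Complex.exp_periodic.sub_int_mul_eq]

/-- Lattice translations preserve `weight`, whose period is the mesh, and lattice modulations are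
`√2`-periodic. So both factors of `frameInv` commute with lattice shifts. -/
theorem tfShift_frameInv (z : ℤ × ℤ) (g : L2) :
    tfShift (mesh * z.1, mesh * z.2) (frameInv g)
      = frameInv (tfShift (mesh * z.1, mesh * z.2) g) := by
  rw [tfShift_eq, tfShift_eq, ← mul_apply_eq_comp, ← mul_apply_eq_comp]
  congr 1
  have h1 : Commute (mulOp (character (mesh * z.2)) * translation (mesh * z.1))
      (mulOp weightInv) := by
    refine Commute.mul_left (commute_mulOp _ _) (commute_mulOp_translation fun t => ?_).symm
    rw [weightInv_apply, weightInv_apply, weight_sub_mesh_mul]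
  have h2 : Commute (mulOp (character (mesh * z.2)) * translation (mesh * z.1))
      (shiftSeries thetaInvCoeff) :=
    commute_shiftSeries summable_abs_thetaInvCoeff fun j =>
      Commute.mul_left (commute_mulOp_translation fun t => character_sub_sqrt_two_mul t _ _)
        (commute_translation _ _)
  exact (h1.mul_right h2).eq

/-! ### Factorization of the frame operator -/

theorem contDiff_gaussianFun : ContDiff ℝ (⊤ : ℕ∞) gaussianFun := by
  unfold gaussianFun
  fun_prop

theorem inner_tfShift_gaussian_eq {h : ℝ → ℂ} {f : L2} (hf : f =ᵐ[volume] h) (p : ℝ × ℝ) :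
    inner ℂ (tfShift p gaussian) f =
      ∫ t : ℝ, Complex.exp (-(2 * Real.pi * Complex.I * p.2 * t)) *
        (gaussianFun (t - p.1) * h t) := by
  rw [L2.inner_def]
  refine integral_congr_ae ?_
  filter_upwards [coeFn_tfShift_gaussian p, hf] with t h1 h2
  rw [h1, h2, RCLike.inner_apply, map_mul, Complex.conj_ofReal, ← Complex.exp_conj]
  have : (starRingEnd ℂ) (2 * Real.pi * Complex.I * p.2 * t) =
      -(2 * Real.pi * Complex.I * p.2 * t) := by
    simp only [map_mul, Complex.conj_ofReal, Complex.conj_I, map_ofNat]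
    ring
  rw [this]
  ring

theorem hasCompactSupport_comp_mul {h : ℝ → ℂ} (hc : HasCompactSupport h) {a : ℝ} (ha : a ≠ 0) :
    HasCompactSupport fun s => h (a * s) :=
  hc.comp_homeomorph (Homeomorph.mulLeft₀ a ha)

open SchwartzMap FourierTransform in
/-- Poisson summation for the Gabor coefficients on a vertical line. -/
theorem hasSum_inner_gaborAtom_mul {h : ℝ → ℂ} (hc : HasCompactSupport h)
    (hd : ContDiff ℝ (⊤ : ℕ∞) h) {f : L2} (hf : f =ᵐ[volume] h) (k : ℤ) (t : ℝ) :
    HasSum (fun l : ℤ => inner ℂ (gaborAtom (k, l)) f *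
        Complex.exp (2 * Real.pi * Complex.I * ((mesh * l : ℝ) : ℂ) * t))
      (√2 * ∑' j : ℤ, (gaussianFun (t - √2 * j - mesh * k) : ℂ) * h (t - √2 * j)) := by
  have h2 : √2 ≠ 0 := by positivity
  have hms := mesh_mul_sqrt_two
  have hFc : HasCompactSupport fun s : ℝ => (gaussianFun (√2 * s - mesh * k) : ℂ) * h (√2 * s) :=
    (hasCompactSupport_comp_mul hc h2).mul_left
  have hFd : ContDiff ℝ (⊤ : ℕ∞)
      fun s : ℝ => (gaussianFun (√2 * s - mesh * k) : ℂ) * h (√2 * s) := by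
    refine ContDiff.mul ?_ ?_
    · exact Complex.ofRealCLM.contDiff.comp (contDiff_gaussianFun.comp (by fun_prop))
    · exact hd.comp (by fun_prop)
  -- The dilation by `√2` turns the frequencies `mesh * l` into integers, so Poisson summation
  -- applies to `F`, at the point `mesh * t`.
  let F : 𝓢(ℝ, ℂ) := hFc.toSchwartzMap hFd
  have hF : ∀ s, F s = (gaussianFun (√2 * s - mesh * k) : ℂ) * h (√2 * s) := fun s => rfl
  have hcoef : ∀ l : ℤ, inner ℂ (gaborAtom (k, l)) f = √2 * (𝓕 F) l := by
    intro l
    rw [gaborAtom, inner_tfShift_gaussian_eq hf, SchwartzMap.fourier_coe,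
      Real.fourier_real_eq_integral_exp_smul]
    have := Measure.integral_comp_mul_left (fun t : ℝ =>
      Complex.exp (-(2 * Real.pi * Complex.I * ((mesh * l : ℝ) : ℂ) * t)) *
        (gaussianFun (t - mesh * k) * h t)) √2
    rw [abs_of_pos (by positivity), Complex.real_smul] at this
    have e : ∀ s : ℝ, Complex.exp (((-2 * Real.pi * s * l : ℝ) : ℂ) * Complex.I) • F s =
        Complex.exp (-(2 * Real.pi * Complex.I * ((mesh * l : ℝ) : ℂ) * ((√2 * s : ℝ) : ℂ))) *
        (gaussianFun (√2 * s - mesh * k) * h (√2 * s)) := by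
      intro s
      rw [hF, smul_eq_mul]
      congr 2
      have h3 := congrArg (fun r : ℝ => (r : ℂ)) hms
      push_cast at h3 ⊢
      linear_combination (2 * Real.pi * Complex.I * l * s) * h3
    simp_rw [e]
    rw [this, ← mul_assoc]
    have h4 : ((√2 : ℝ) : ℂ) * (((√2)⁻¹ : ℝ) : ℂ) = 1 := by
      rw [← Complex.ofReal_mul, mul_inv_cancel₀ h2, Complex.ofReal_one]
    rw [h4, one_mul]
  have hsum : Summable fun l : ℤ => (𝓕 F) l := by
    exact summable_of_isBigO (Real.summable_abs_int_rpow one_lt_two)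
      (((𝓕 F).isBigO_cocompact_rpow (-2)).comp_tendsto Int.tendsto_coe_cofinite)
  have hpois := F.tsum_eq_tsum_fourier (mesh * t)
  have hs : Summable fun l : ℤ => inner ℂ (gaborAtom (k, l)) f *
        Complex.exp (2 * Real.pi * Complex.I * ((mesh * l : ℝ) : ℂ) * t) := by
    refine Summable.of_norm ?_
    simp_rw [norm_mul, norm_exp_two_pi, mul_one, hcoef, norm_mul]
    exact hsum.norm.mul_left _
  convert hs.hasSum using 1
  have e2 : ∀ l : ℤ, inner ℂ (gaborAtom (k, l)) f *
        Complex.exp (2 * Real.pi * Complex.I * ((mesh * l : ℝ) : ℂ) * t) =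
      √2 * ((𝓕 F) l * fourier l ((mesh * t : ℝ) : UnitAddCircle)) := by
    intro l
    rw [hcoef, fourier_coe_apply, mul_assoc]
    congr 3
    push_cast
    ring
  simp_rw [e2]
  rw [tsum_mul_left, ← hpois, ← (Equiv.neg ℤ).tsum_eq]
  congr 1
  refine tsum_congr fun j => ?_
  rw [hF]
  have e3 : √2 * (mesh * t + (j : ℝ)) = t - √2 * ((-j : ℤ) : ℝ) := by
    push_cast
    linear_combination t * hms
  simp only [Equiv.neg_apply, e3]

/-- The identity that factorizes the frame operator. The two centres have midpoint `mesh * (k + j)`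
because `√2 = 2 * mesh`; hence `j` enters only through `thetaCoeff j` and an integer shift of `k`.
-/
theorem gaussianFun_mul_gaussianFun_shift (t : ℝ) (k j : ℤ) :
    √2 * (gaussianFun (t - mesh * k) * gaussianFun (t - √2 * j - mesh * k)) =
      2 * thetaCoeff j * Real.exp (-Real.pi * 1 * (√2 * t - ((k + j : ℤ) : ℝ)) ^ 2) := by
  have h2 : √2 * √2 = 2 := Real.mul_self_sqrt zero_le_two
  have hms := mesh_mul_sqrt_two
  have h := gaussianFun_mul_gaussianFun (mesh * k) (√2 * j + mesh * k) t
  rw [sub_sub t, h, thetaCoeff_eq, ← mul_assoc, ← mul_assoc, h2]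
  congr 2
  · congr 1
    linear_combination (-Real.pi / 2 * j ^ 2) * h2
  · have hm : √2 = 2 * mesh := by linear_combination (-√2) * hms + mesh * h2
    have e : t - (mesh * k + (√2 * j + mesh * k)) / 2 = t - mesh * (k + j) := by
      rw [hm]; ring
    rw [e]
    have e2 : √2 * (t - mesh * (k + j)) = √2 * t - ((k + j : ℤ) : ℝ) := by
      push_cast
      linear_combination (-(k + j : ℝ)) * hms
    rw [← e2, mul_pow, Real.sq_sqrt zero_le_two]
    ring

/-- For fixed `t` the sums over `j` are finite, so they can be interchanged with the sum over `k`
without any estimate. -/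
theorem finite_support_translates {h : ℝ → ℂ} (hc : HasCompactSupport h) (t : ℝ) :
    ∃ J : Finset ℤ, ∀ j ∉ J, h (t - √2 * j) = 0 := by
  obtain ⟨R, hR⟩ := hc.isCompact.isBounded.subset_closedBall 0
  have h2 : 1 ≤ √2 := Real.one_le_sqrt.2 one_le_two
  refine ⟨Finset.Icc (-⌈|t| + |R|⌉) ⌈|t| + |R|⌉, fun j hj => ?_⟩
  by_contra hne
  have h1 := hR (subset_tsupport h hne)
  rw [mem_closedBall_zero_iff, Real.norm_eq_abs] at h1
  apply hj
  have h3 : |(j : ℝ)| ≤ |t| + |R| := by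
    calc |(j : ℝ)| ≤ √2 * |(j : ℝ)| := le_mul_of_one_le_left (abs_nonneg _) h2
      _ = |√2 * j| := by rw [abs_mul, abs_of_nonneg (Real.sqrt_nonneg 2)]
      _ = |t - (t - √2 * j)| := by rw [sub_sub_cancel]
      _ ≤ |t| + |t - √2 * j| := abs_sub _ _
      _ ≤ |t| + |R| := add_le_add le_rfl (h1.trans (le_abs_self R))
  obtain ⟨h4, h5⟩ := abs_le.1 (h3.trans (Int.le_ceil _))
  rw [Finset.mem_Icc]
  exact ⟨by exact_mod_cast h4, by exact_mod_cast h5⟩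

theorem frameOperator_gaborAtom_of_hasCompactSupport {h : ℝ → ℂ} (hc : HasCompactSupport h)
    (hd : ContDiff ℝ (⊤ : ℕ∞) h) {f : L2} (hf : f =ᵐ[volume] h) :
    frameOperator gaborAtom f = frameFactorization f := by
  have hB : (0 : ℝ) ≤ (201 / 100) ^ 2 := by norm_num
  have hsum := isBessel_gaborAtom.summable_inner_smul hB f
  have hfib : ∀ k : ℤ, (∑' l : ℤ, inner ℂ (gaborAtom (k, l)) f • gaborAtom (k, l) : L2)
      =ᵐ[volume] fun t => √2 * (gaussianFun (t - mesh * k) : ℂ) *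
        ∑' j : ℤ, (gaussianFun (t - √2 * j - mesh * k) : ℂ) * h (t - √2 * j) := by
    intro k
    refine ae_eq_of_hasSum (hsum.prod_factor k).hasSum ?_
    have hae : ∀ᵐ t, ∀ l : ℤ, (inner ℂ (gaborAtom (k, l)) f • gaborAtom (k, l) : L2) t =
        inner ℂ (gaborAtom (k, l)) f *
          (Complex.exp (2 * Real.pi * Complex.I * ((mesh * l : ℝ) : ℂ) * t) *
            gaussianFun (t - mesh * k)) := by
      refine ae_all_iff.2 fun l => ?_
      filter_upwards [Lp.coeFn_smul (inner ℂ (gaborAtom (k, l)) f) (gaborAtom (k, l)),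
        coeFn_tfShift_gaussian (mesh * k, mesh * l)] with t h1 h2
      rw [h1, Pi.smul_apply, smul_eq_mul, gaborAtom, h2]
    filter_upwards [hae] with t ht
    simp_rw [ht]
    rw [mul_right_comm (√2 : ℂ)]
    simpa only [mul_assoc] using (hasSum_inner_gaborAtom_mul hc hd hf k t).mul_right
      (gaussianFun (t - mesh * k) : ℂ)
  have hS : frameOperator gaborAtom f =ᵐ[volume]
      fun t => weight t * ∑' j : ℤ, (thetaCoeff j : ℂ) * h (t - √2 * j) := by
    refine ae_eq_of_hasSum (hsum.hasSum.prod_fiberwise fun k => (hsum.prod_factor k).hasSum) ?_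
    filter_upwards [ae_all_iff.2 hfib] with t ht
    obtain ⟨J, hJ⟩ := finite_support_translates hc t
    simp_rw [ht]
    rw [tsum_eq_sum (s := J) (fun j hj => by rw [hJ j hj, mul_zero]), Finset.mul_sum]
    have e : ∀ k : ℤ, √2 * (gaussianFun (t - mesh * k) : ℂ) *
        (∑' j : ℤ, (gaussianFun (t - √2 * j - mesh * k) : ℂ) * h (t - √2 * j)) =
        ∑ j ∈ J, ((2 * Real.exp (-Real.pi * 1 * (√2 * t - ((k + j : ℤ) : ℝ)) ^ 2) : ℝ) : ℂ) *
          ((thetaCoeff j : ℂ) * h (t - √2 * j)) := by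
      intro k
      rw [tsum_eq_sum (s := J) (fun j hj => by rw [hJ j hj, mul_zero]), Finset.mul_sum]
      refine Finset.sum_congr rfl fun j _ => ?_
      have := congrArg (fun r : ℝ => (r : ℂ)) (gaussianFun_mul_gaussianFun_shift t k j)
      push_cast at this ⊢
      linear_combination h (t - √2 * j) * this
    simp_rw [e]
    refine hasSum_sum fun j _ => HasSum.mul_right _ ?_
    rw [weight_apply]
    refine Complex.hasSum_ofReal.2 (HasSum.mul_left _ ?_)
    -- Summation over all `k` absorbs the shift by `j`, so every `j` carries the same factor `weight
    -- t`.
    exact (Equiv.addRight j).hasSum_iff.2 (summable_exp_neg_pi_mul_sq one_pos (√2 * t)).hasSum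
  have hC : shiftSeries thetaCoeff f =ᵐ[volume]
      fun t => ∑' j : ℤ, (thetaCoeff j : ℂ) * h (t - √2 * j) := by
    refine ae_eq_of_hasSum (hasSum_shiftSeries summable_abs_thetaCoeff f) ?_
    have hae : ∀ᵐ t, ∀ j : ℤ, ((thetaCoeff j : ℂ) • translation (√2 * j) f : L2) t =
        (thetaCoeff j : ℂ) * h (t - √2 * j) := by
      refine ae_all_iff.2 fun j => ?_
      filter_upwards [Lp.coeFn_smul (thetaCoeff j : ℂ) (translation (√2 * j) f),
        coeFn_translation (√2 * j) f, ae_eq_comp_sub hf (√2 * j)] with t h1 h2 h3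
      rw [h1, Pi.smul_apply, smul_eq_mul, h2, h3]
    filter_upwards [hae] with t ht
    obtain ⟨J, hJ⟩ := finite_support_translates hc t
    simp_rw [ht]
    exact (summable_of_ne_finset_zero (s := J) fun j hj => by rw [hJ j hj, mul_zero]).hasSum
  refine Lp.ext ?_
  rw [frameFactorization, mul_apply_eq_comp]
  filter_upwards [hS, hC, coeFn_mulOp weight (shiftSeries thetaCoeff f)] with t h1 h2 h3
  rw [h1, h3, h2]

/-- Both sides are continuous in `f`, and smooth compactly supported functions are dense. -/
theorem frameOperator_gaborAtom (f : L2) : frameOperator gaborAtom f = frameFactorization f := by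
  have hcont := isBessel_gaborAtom.continuous_frameOperator (by norm_num)
  have hclosed : IsClosed {f : L2 | frameOperator gaborAtom f = frameFactorization f} :=
    isClosed_eq hcont frameFactorization.continuous
  have hdense := Lp.dense_hasCompactSupport_contDiff (E := ℝ) (F := ℂ) (μ := volume)
    (p := 2) ENNReal.ofNat_ne_top
  refine hclosed.closure_subset_iff.2 ?_ (hdense f)
  rintro g ⟨h, hg, hc, hd⟩
  exact frameOperator_gaborAtom_of_hasCompactSupport hc hd hg

/-! ### The dual window -/

/-- The lattice point with the given integer coordinates. -/
def latticePoint (z : ℤ × ℤ) : ℝ × ℝ := (mesh * z.1, mesh * z.2)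

theorem latticePoint_injective : Function.Injective latticePoint := fun z w h => by
  have hm := mesh_pos.ne'
  simp only [latticePoint, Prod.mk.injEq, mul_eq_mul_left_iff, Int.cast_inj, hm, or_false] at h
  exact Prod.ext h.1 h.2

/-- The lattice is parametrized by `ℤ²`. -/
def latticeEquiv : ℤ × ℤ ≃ lattice := Equiv.ofInjective latticePoint latticePoint_injective

theorem frameOperator_gaborSystem (f : L2) :
    frameOperator gaborSystem f = frameFactorization f := by
  rw [← frameOperator_gaborAtom, frameOperator, frameOperator, ← latticeEquiv.tsum_eq]
  rfl

/-- The right inverse shows that the Gaussian is in the range, so `invFun` returns a genuine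
preimage; the left inverse makes this preimage unique. -/
theorem dualWindow_eq : dualWindow = frameInv gaussian := by
  have h1 : frameOperator gaborSystem (frameInv gaussian) = gaussian := by
    rw [frameOperator_gaborSystem, ← mul_apply_eq_comp, frameFactorization_mul_frameInv,
      one_apply_eq_self]
  have h2 : frameOperator gaborSystem dualWindow = gaussian := Function.invFun_eq ⟨_, h1⟩
  have h3 := congrArg frameInv h2
  rwa [frameOperator_gaborSystem, ← mul_apply_eq_comp, frameInv_mul_frameFactorization,
    one_apply_eq_self] at h3

theorem tfShift_dualWindow (z : ℤ × ℤ) :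
    tfShift (mesh * z.1, mesh * z.2) dualWindow = frameInv (gaborAtom z) := by
  rw [dualWindow_eq, tfShift_frameInv, gaborAtom]

theorem hasSum_reconstruction (f : L2) :
    HasSum (fun z => inner ℂ (gaborAtom z) f • frameInv (gaborAtom z)) f := by
  have h := (isBessel_gaborAtom.summable_inner_smul (by norm_num) f).hasSum.mapL frameInv
  simp only [map_smul] at h
  convert h using 1
  have := frameOperator_gaborAtom f
  rw [frameOperator] at this
  rw [this, ← mul_apply_eq_comp, frameInv_mul_frameFactorization, one_apply_eq_self]

/-! ### A mean value inequality for entire functions -/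

theorem two_pi_mul_enorm_le_lintegral_circle {F : ℂ → ℂ} (hF : Differentiable ℂ F) (r : ℝ) :
    ENNReal.ofReal (2 * Real.pi) * ‖F 0‖ₑ ≤
      ∫⁻ θ in Ioo (-Real.pi) Real.pi, ‖F (circleMap 0 r θ)‖ₑ := by
  have hπ := Real.pi_pos
  have h1 : Real.circleAverage F 0 r = F 0 := hF.diffContOnCl.circleAverage
  rw [Real.circleAverage_eq_integral_add (-Real.pi),
    intervalIntegral.integral_comp_add_right (fun θ => F (circleMap 0 r θ)),
    show (0 : ℝ) + -Real.pi = -Real.pi by ring, show 2 * Real.pi + -Real.pi = Real.pi by ring,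
    intervalIntegral.integral_of_le (by linarith), integral_Ioc_eq_integral_Ioo] at h1
  rw [← h1, enorm_smul, Real.enorm_of_nonneg (by positivity), ← mul_assoc,
    ← ENNReal.ofReal_mul (by positivity), mul_inv_cancel₀ (by positivity), ENNReal.ofReal_one,
    one_mul]
  exact enorm_integral_le_lintegral_enorm _

theorem lintegral_ofReal_Ioo {R : ℝ} (hR : 0 ≤ R) :
    ∫⁻ r in Ioo 0 R, ENNReal.ofReal r = ENNReal.ofReal (R ^ 2 / 2) := by
  have h : IntegrableOn (fun r : ℝ => r) (Ioo 0 R) :=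
    (continuous_id.integrableOn_Icc (a := 0) (b := R)).mono_set Ioo_subset_Icc_self
  rw [← ofReal_integral_eq_lintegral_ofReal h
    ((ae_restrict_mem measurableSet_Ioo).mono fun r hr => hr.1.le),
    ← integral_Ioc_eq_integral_Ioo, ← intervalIntegral.integral_of_le hR, integral_id]
  simp

/-- The mean value property on circles, integrated against `r dr` in polar coordinates. -/
theorem pi_mul_enorm_le_lintegral_disc {F : ℂ → ℂ} (hF : Differentiable ℂ F) {R : ℝ}
    (hR : 0 ≤ R) :
    ENNReal.ofReal (Real.pi * R ^ 2) * ‖F 0‖ₑ ≤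
      ∫⁻ p in {p : ℝ × ℝ | p.1 ^ 2 + p.2 ^ 2 < R ^ 2}, ‖F (p.1 + p.2 * Complex.I)‖ₑ := by
  have hmeas : MeasurableSet {p : ℝ × ℝ | p.1 ^ 2 + p.2 ^ 2 < R ^ 2} :=
    (isOpen_lt (by fun_prop) (by fun_prop)).measurableSet
  have hcont := hF.continuous
  rw [← lintegral_indicator hmeas, ← lintegral_comp_polarCoord_symm]
  have hsub : Ioo 0 R ×ˢ Ioo (-Real.pi) Real.pi ⊆ polarCoord.target :=
    prod_mono Ioo_subset_Ioi_self subset_rfl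
  refine le_trans ?_ (lintegral_mono_set hsub)
  have hms : MeasurableSet (Ioo 0 R ×ˢ Ioo (-Real.pi) Real.pi) :=
    measurableSet_Ioo.prod measurableSet_Ioo
  have hval : ∀ q ∈ Ioo 0 R ×ˢ Ioo (-Real.pi) Real.pi,
      ENNReal.ofReal q.1 • ({p : ℝ × ℝ | p.1 ^ 2 + p.2 ^ 2 < R ^ 2}.indicator
        (fun p => ‖F (p.1 + p.2 * Complex.I)‖ₑ)) (polarCoord.symm q) =
      ENNReal.ofReal q.1 * ‖F (circleMap 0 q.1 q.2)‖ₑ := by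
    rintro ⟨r, θ⟩ ⟨hr, -⟩
    have hmem : polarCoord.symm (r, θ) ∈ {p : ℝ × ℝ | p.1 ^ 2 + p.2 ^ 2 < R ^ 2} := by
      simp only [polarCoord_symm_apply, mem_ofPred_eq]
      have : (r * Real.cos θ) ^ 2 + (r * Real.sin θ) ^ 2 = r ^ 2 := by
        have := Real.cos_sq_add_sin_sq θ
        linear_combination r ^ 2 * this
      rw [this]
      exact pow_lt_pow_left₀ hr.2 hr.1.le two_ne_zero
    rw [indicator_of_mem hmem, smul_eq_mul]
    congr 3
    rw [circleMap, Complex.exp_mul_I]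
    simp only [polarCoord_symm_apply]
    push_cast
    ring
  rw [setLIntegral_congr_fun hms hval, Measure.volume_eq_prod,
    setLIntegral_prod _ (by
      refine Measurable.aemeasurable ?_
      have : Continuous fun q : ℝ × ℝ => F (circleMap 0 q.1 q.2) := by
        refine hcont.comp ?_
        unfold circleMap
        fun_prop
      exact (ENNReal.measurable_ofReal.comp measurable_fst).mul this.enorm.measurable)]
  calc ENNReal.ofReal (Real.pi * R ^ 2) * ‖F 0‖ₑ
      = ∫⁻ r in Ioo 0 R, ENNReal.ofReal r * (ENNReal.ofReal (2 * Real.pi) * ‖F 0‖ₑ) := by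
        rw [lintegral_mul_const _ ENNReal.measurable_ofReal, lintegral_ofReal_Ioo hR, ← mul_assoc,
          ← ENNReal.ofReal_mul (by positivity)]
        congr 2
        ring
    _ ≤ _ := by
        refine lintegral_mono fun r => ?_
        rw [lintegral_const_mul' _ _ ENNReal.ofReal_ne_top]
        gcongr
        exact two_pi_mul_enorm_le_lintegral_circle hF r

/-! ### The Bargmann transform -/

theorem memLp_exp_neg_sq_add (c : ℝ) :
    MemLp (fun t : ℝ => Real.exp (-Real.pi * t ^ 2 + c * |t|)) 2 volume := by
  have hcont : Continuous fun t : ℝ => Real.exp (-Real.pi * t ^ 2 + c * |t|) := by fun_prop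
  rw [memLp_two_iff_integrable_sq_norm hcont.aestronglyMeasurable]
  refine ((integrable_exp_neg_mul_sq Real.pi_pos).const_mul
    (Real.exp (c ^ 2 / Real.pi))).mono' (by fun_prop) (Filter.Eventually.of_forall fun t => ?_)
  rw [norm_pow, norm_norm, Real.norm_of_nonneg (Real.exp_pos _).le, ← Real.exp_nat_mul,
    ← Real.exp_add]
  apply Real.exp_le_exp.2
  have hπ := Real.pi_pos
  have h : 0 ≤ (Real.pi * |t| - c) ^ 2 / Real.pi := by positivity
  have e : (Real.pi * |t| - c) ^ 2 / Real.pi = Real.pi * t ^ 2 - 2 * c * |t| + c ^ 2 / Real.pi := by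
    rw [← sq_abs t]
    field_simp
    ring
  push_cast
  linarith

/-- The entire function `z ↦ ∫ φ(t) e^{2πtz} f(t) dt`. -/
def bargmann (f : L2) (z : ℂ) : ℂ :=
  ∫ t : ℝ, Complex.exp (2 * Real.pi * t * z) * (gaussianFun t * f t)

theorem integrable_exp_mul_norm (f : L2) (c : ℝ) :
    Integrable fun t : ℝ => Real.exp (-Real.pi * t ^ 2 + c * |t|) * ‖f t‖ :=
  (memLp_exp_neg_sq_add c).integrable_mul (Lp.memLp f).norm

theorem norm_exp_mul_gaussianFun_le (t : ℝ) (z : ℂ) {R : ℝ} (hz : ‖z‖ ≤ R) :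
    ‖Complex.exp (2 * Real.pi * t * z) * (gaussianFun t : ℂ)‖ ≤
      2 ^ (1 / 4 : ℝ) * Real.exp (-Real.pi * t ^ 2 + 2 * Real.pi * R * |t|) := by
  rw [norm_mul, Complex.norm_real, Real.norm_of_nonneg (gaussianFun_pos t).le, gaussianFun,
    mul_left_comm, Complex.norm_exp, add_comm (-Real.pi * t ^ 2), Real.exp_add]
  gcongr
  have hπ := Real.pi_pos
  refine (Complex.re_le_norm _).trans ?_
  rw [norm_mul, norm_mul, norm_mul, Complex.norm_real, Complex.norm_real,
    Real.norm_of_nonneg hπ.le, Complex.norm_two, Real.norm_eq_abs]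
  have := mul_le_mul_of_nonneg_left hz (abs_nonneg t)
  nlinarith

theorem differentiable_bargmann (f : L2) : Differentiable ℂ (bargmann f) := by
  intro z₀
  have hmeas : ∀ z : ℂ, AEStronglyMeasurable
      (fun t : ℝ => Complex.exp (2 * Real.pi * t * z) * (gaussianFun t * f t)) volume := by
    intro z
    have h1 : Continuous fun t : ℝ => Complex.exp (2 * Real.pi * t * z) := by fun_prop
    have h2 : Continuous fun t : ℝ => (gaussianFun t : ℂ) :=
      Complex.continuous_ofReal.comp contDiff_gaussianFun.continuous
    exact h1.aestronglyMeasurable.mul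
      (h2.aestronglyMeasurable.mul (Lp.aestronglyMeasurable f))
  set R := ‖z₀‖ + 1 with hR
  have hbound : ∀ (t : ℝ) (z : ℂ), ‖z‖ ≤ R →
      ‖Complex.exp (2 * Real.pi * t * z) * (gaussianFun t * f t)‖ ≤
      2 ^ (1 / 4 : ℝ) * (Real.exp (-Real.pi * t ^ 2 + 2 * Real.pi * R * |t|) * ‖f t‖) := by
    intro t z hz
    rw [← mul_assoc, norm_mul, ← mul_assoc]
    gcongr
    exact norm_exp_mul_gaussianFun_le t z hz
  have hint : Integrable
      (fun t : ℝ => Complex.exp (2 * Real.pi * t * z₀) * (gaussianFun t * f t)) :=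
    ((integrable_exp_mul_norm f (2 * Real.pi * R)).const_mul (2 ^ (1 / 4 : ℝ))).mono' (hmeas z₀)
      (Filter.Eventually.of_forall fun t => hbound t z₀ (by linarith))
  have hid : Continuous fun t : ℝ => (2 * Real.pi * t : ℂ) := by fun_prop
  refine (hasDerivAt_integral_of_dominated_loc_of_deriv_le (𝕜 := ℂ) (μ := volume)
    (F := fun z (t : ℝ) => Complex.exp (2 * Real.pi * t * z) * (gaussianFun t * f t))
    (F' := fun z (t : ℝ) => 2 * Real.pi * t *
      (Complex.exp (2 * Real.pi * t * z) * (gaussianFun t * f t)))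
    (bound := fun t => 2 * Real.pi * 2 ^ (1 / 4 : ℝ) *
      (Real.exp (-Real.pi * t ^ 2 + (2 * Real.pi * R + 1) * |t|) * ‖f t‖))
    (Metric.ball_mem_nhds z₀ one_pos) (Filter.Eventually.of_forall hmeas) hint
    (hid.aestronglyMeasurable.mul (hmeas z₀)) ?_
    ((integrable_exp_mul_norm f _).const_mul _) ?_).2.differentiableAt
  · refine Filter.Eventually.of_forall fun t z hz => ?_
    have hz' : ‖z‖ ≤ R := by
      have h1 := norm_sub_norm_le z z₀
      have h2 := mem_ball_iff_norm.1 hz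
      linarith
    have hπ := Real.pi_pos
    have h1 : ‖(2 * Real.pi * t : ℂ)‖ = 2 * Real.pi * |t| := by
      rw [norm_mul, norm_mul, Complex.norm_real, Complex.norm_real, Complex.norm_two,
        Real.norm_of_nonneg hπ.le, Real.norm_eq_abs]
    rw [norm_mul, h1]
    -- The factor `t` produced by differentiation is absorbed by raising the linear exponent by
    -- `|t|`.
    have h2 : |t| ≤ Real.exp |t| := by linarith [Real.add_one_le_exp |t|]
    have h3 : Real.exp (-Real.pi * t ^ 2 + (2 * Real.pi * R + 1) * |t|) =
        Real.exp |t| * Real.exp (-Real.pi * t ^ 2 + 2 * Real.pi * R * |t|) := by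
      rw [← Real.exp_add]
      congr 1
      ring
    rw [h3]
    calc _ ≤ 2 * Real.pi * Real.exp |t| * (2 ^ (1 / 4 : ℝ) *
          (Real.exp (-Real.pi * t ^ 2 + 2 * Real.pi * R * |t|) * ‖f t‖)) := by
          gcongr
          exact hbound t z hz'
      _ = _ := by ring
  · refine Filter.Eventually.of_forall fun t z _ => ?_
    have h1 : HasDerivAt (fun z : ℂ => Complex.exp (2 * Real.pi * t * z))
        (Complex.exp (2 * Real.pi * t * z) * (2 * Real.pi * t)) z := by
      simpa using ((hasDerivAt_id z).const_mul (2 * Real.pi * t : ℂ)).cexp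
    exact (h1.mul_const ((gaussianFun t : ℂ) * f t)).congr_deriv (by ring)

theorem gaborTransform_eq_bargmann (f : L2) (p : ℝ × ℝ) :
    gaborTransform f p = Complex.exp (-Real.pi * p.1 ^ 2) * bargmann f (p.1 - p.2 * Complex.I) := by
  rw [gaborTransform, inner_tfShift_gaussian_eq (Filter.EventuallyEq.refl _ _), bargmann,
    ← integral_const_mul]
  refine integral_congr_ae (Filter.Eventually.of_forall fun t => ?_)
  simp only [gaussianFun]
  push_cast
  have e : Complex.exp (-(2 * Real.pi * Complex.I * p.2 * t)) *
      Complex.exp (-Real.pi * (t - p.1) ^ 2) = Complex.exp (-Real.pi * p.1 ^ 2) *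
      Complex.exp (2 * Real.pi * t * (p.1 - p.2 * Complex.I)) *
      Complex.exp (-Real.pi * t ^ 2) := by
    rw [← Complex.exp_add, ← Complex.exp_add, ← Complex.exp_add]
    congr 1
    ring
  linear_combination (((2 : ℝ) ^ (1 / 4 : ℝ) : ℝ) : ℂ) * f t * e

theorem continuous_gaborTransform (f : L2) : Continuous (gaborTransform f) := by
  have h := (differentiable_bargmann f).continuous
  rw [funext (gaborTransform_eq_bargmann f)]
  fun_prop

/-- A zero-free entire factor recentres the Gaussian weight at `(x, ω)`. The weight is then 1 at the
centre and at most `e^{πR²}` on the disc of radius `R`, as the mean value inequality needs. -/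
theorem norm_sq_bargmann_mul_exp (f : L2) (x ω u v : ℝ) :
    ‖(bargmann f (x - ω * Complex.I + (u + v * Complex.I)) *
      Complex.exp (-Real.pi * x ^ 2 - 2 * Real.pi * x * (u + v * Complex.I)
        - Real.pi / 2 * (u + v * Complex.I) ^ 2)) ^ 2‖ =
      Real.exp (Real.pi * (u ^ 2 + v ^ 2)) * ‖gaborTransform f (x + u, ω - v)‖ ^ 2 := by
  have e1 : (x - ω * Complex.I + (u + v * Complex.I) : ℂ) =
      ((x + u : ℝ) : ℂ) - ((ω - v : ℝ) : ℂ) * Complex.I := by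
    push_cast
    ring
  have e2 : (-Real.pi * x ^ 2 - 2 * Real.pi * x * (u + v * Complex.I)
        - Real.pi / 2 * (u + v * Complex.I) ^ 2 : ℂ) =
      ((-Real.pi * x ^ 2 - 2 * Real.pi * x * u - Real.pi / 2 * (u ^ 2 - v ^ 2) : ℝ) : ℂ) +
        ((-2 * Real.pi * x * v - Real.pi * u * v : ℝ) : ℂ) * Complex.I := by
    push_cast
    linear_combination (-Real.pi / 2 * v ^ 2) * Complex.I_sq
  have e3 : (-Real.pi * ((x + u : ℝ) : ℂ) ^ 2 : ℂ) = ((-Real.pi * (x + u) ^ 2 : ℝ) : ℂ) := by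
    push_cast
    ring
  rw [gaborTransform_eq_bargmann, e1, e2, e3, Complex.exp_add, norm_pow, norm_mul, norm_mul,
    norm_mul, Complex.norm_exp_ofReal_mul_I, mul_one, ← Complex.ofReal_exp, ← Complex.ofReal_exp,
    Complex.norm_real, Complex.norm_real, Real.norm_of_nonneg (Real.exp_pos _).le,
    Real.norm_of_nonneg (Real.exp_pos _).le, mul_pow, mul_pow, ← Real.exp_nat_mul,
    ← Real.exp_nat_mul, ← mul_assoc, ← Real.exp_add, mul_comm]
  congr 2
  push_cast
  ring

theorem setLIntegral_comp_add_left (g : ℝ → ℝ≥0∞) (x R : ℝ) :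
    ∫⁻ u in Ioo (-R) R, g (x + u) = ∫⁻ y in Ioo (x - R) (x + R), g y := by
  have h := (measurePreserving_add_left volume x).setLIntegral_comp_preimage_emb
    (MeasurableEquiv.addLeft x).measurableEmbedding g (Ioo (x - R) (x + R))
  rw [← h, preimage_const_add_Ioo]
  congr 3 <;> ring

theorem setLIntegral_comp_sub_left (g : ℝ → ℝ≥0∞) (ω R : ℝ) :
    ∫⁻ v in Ioo (-R) R, g (ω - v) = ∫⁻ ξ in Ioo (ω - R) (ω + R), g ξ := by
  have h := (Measure.measurePreserving_sub_left volume ω).setLIntegral_comp_preimage_emb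
    (MeasurableEquiv.subLeft ω).measurableEmbedding g (Ioo (ω - R) (ω + R))
  rw [← h, preimage_const_sub_Ioo]
  congr 3 <;> ring

/-- The mean value inequality on a disc, which is then enlarged to a square so that time and
frequency integrals separate. -/
theorem pi_mul_sq_gaborTransform_le (f : L2) (x ω : ℝ) {R : ℝ} (hR : 0 ≤ R) :
    ENNReal.ofReal (Real.pi * R ^ 2) * ‖gaborTransform f (x, ω)‖ₑ ^ 2 ≤
      ENNReal.ofReal (Real.exp (Real.pi * R ^ 2)) *
        ∫⁻ y in Ioo (x - R) (x + R), ∫⁻ ξ in Ioo (ω - R) (ω + R),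
          ‖gaborTransform f (y, ξ)‖ₑ ^ 2 := by
  have hcont := continuous_gaborTransform f
  let F : ℂ → ℂ := fun w => (bargmann f (x - ω * Complex.I + w) *
      Complex.exp (-Real.pi * x ^ 2 - 2 * Real.pi * x * w - Real.pi / 2 * w ^ 2)) ^ 2
  have hF : Differentiable ℂ F := by
    have := differentiable_bargmann f
    fun_prop
  have hnorm : ∀ u v : ℝ, ‖F (u + v * Complex.I)‖ₑ =
      ENNReal.ofReal (Real.exp (Real.pi * (u ^ 2 + v ^ 2))) *
        ‖gaborTransform f (x + u, ω - v)‖ₑ ^ 2 := by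
    intro u v
    rw [← ofReal_norm, norm_sq_bargmann_mul_exp, ENNReal.ofReal_mul (Real.exp_pos _).le,
      ENNReal.ofReal_pow (norm_nonneg _), ofReal_norm]
  have h0 : ‖F 0‖ₑ = ‖gaborTransform f (x, ω)‖ₑ ^ 2 := by
    simpa using hnorm 0 0
  have hdisc : MeasurableSet {p : ℝ × ℝ | p.1 ^ 2 + p.2 ^ 2 < R ^ 2} :=
    (isOpen_lt (by fun_prop) (by fun_prop)).measurableSet
  have hsub : {p : ℝ × ℝ | p.1 ^ 2 + p.2 ^ 2 < R ^ 2} ⊆ Ioo (-R) R ×ˢ Ioo (-R) R := by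
    intro p hp
    have hp' : p.1 ^ 2 + p.2 ^ 2 < R ^ 2 := hp
    exact ⟨abs_lt.1 (abs_lt_of_sq_lt_sq (by nlinarith [sq_nonneg p.2]) hR),
      abs_lt.1 (abs_lt_of_sq_lt_sq (by nlinarith [sq_nonneg p.1]) hR)⟩
  have h1 := pi_mul_enorm_le_lintegral_disc hF hR
  rw [h0] at h1
  refine h1.trans ?_
  calc _ ≤ ∫⁻ p in {p : ℝ × ℝ | p.1 ^ 2 + p.2 ^ 2 < R ^ 2},
        ENNReal.ofReal (Real.exp (Real.pi * R ^ 2)) *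
          ‖gaborTransform f (x + p.1, ω - p.2)‖ₑ ^ 2 := by
        refine setLIntegral_mono' hdisc fun p hp => ?_
        have hp' : p.1 ^ 2 + p.2 ^ 2 < R ^ 2 := hp
        rw [hnorm]
        gcongr
    _ ≤ ∫⁻ p in Ioo (-R) R ×ˢ Ioo (-R) R, ENNReal.ofReal (Real.exp (Real.pi * R ^ 2)) *
          ‖gaborTransform f (x + p.1, ω - p.2)‖ₑ ^ 2 := lintegral_mono_set hsub
    _ = ENNReal.ofReal (Real.exp (Real.pi * R ^ 2)) *
          ∫⁻ p in Ioo (-R) R ×ˢ Ioo (-R) R, ‖gaborTransform f (x + p.1, ω - p.2)‖ₑ ^ 2 :=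
        lintegral_const_mul' _ _ ENNReal.ofReal_ne_top
    _ = _ := by
        rw [Measure.volume_eq_prod, setLIntegral_prod _ (by
          refine Measurable.aemeasurable (Continuous.measurable ?_)
          fun_prop)]
        dsimp only
        rw [lintegral_congr fun u =>
            setLIntegral_comp_sub_left (fun ξ => ‖gaborTransform f (x + u, ξ)‖ₑ ^ 2) ω R,
          setLIntegral_comp_add_left
          (fun y => ∫⁻ ξ in Ioo (ω - R) (ω + R), ‖gaborTransform f (y, ξ)‖ₑ ^ 2)]

/-! ### Sampling outside a frequency band -/

theorem setLIntegral_sq_gaborTransform_le_kappa (S : ℝ) (f : L2) (x : ℝ) :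
    ∫⁻ ξ in {ξ : ℝ | S < |ξ|}, ‖gaborTransform f (x, ξ)‖ₑ ^ 2 ≤ kappa S f ^ 2 := by
  have h : eLpNorm (fun ω => gaborTransform f (x, ω)) 2 (volume.restrict {ω : ℝ | S < |ω|})
      ≤ kappa S f := le_iSup (fun x : ℝ => eLpNorm (fun ω => gaborTransform f (x, ω)) 2
        (volume.restrict {ω : ℝ | S < |ω|})) x
  refine le_trans (le_of_eq ?_) (pow_le_pow_left' h 2)
  have := eLpNorm_nnreal_pow_eq_lintegral (p := 2) (f := fun ω => gaborTransform f (x, ω))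
    (μ := volume.restrict {ω : ℝ | S < |ω|}) two_ne_zero
  simp only [NNReal.coe_ofNat, ENNReal.coe_ofNat, ENNReal.rpow_ofNat] at this
  exact this.symm

/-- With radius half the mesh the frequency intervals around the samples are disjoint. They lie
outside the band, since the first frequency outside is a full mesh step beyond `mesh * L`. The time
integral, of length `mesh`, is bounded by the supremum in `kappa`. -/
theorem sum_enorm_sq_gaborTransform_le (f : L2) (x : ℝ) (L : ℕ) (F : Finset ℤ)
    (hF : ∀ l ∈ F, (L : ℤ) < |l|) :
    ENNReal.ofReal (23 / 100) * ∑ l ∈ F, ‖gaborTransform f (x, mesh * l)‖ₑ ^ 2 ≤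
      ENNReal.ofReal mesh * kappa (mesh * L) f ^ 2 := by
  have hm := mesh_pos
  have hcont := continuous_gaborTransform f
  set R := mesh / 2 with hR
  have hR2 : Real.pi * R ^ 2 = Real.pi / 8 := by
    rw [hR, div_pow, mesh_sq]
    ring
  have hint : ∀ l ∈ F, ∀ ξ ∈ Ioo (mesh * l - R) (mesh * l + R), mesh * L < |ξ| := by
    intro l hl ξ hξ
    have h1 : (L : ℝ) + 1 ≤ |(l : ℝ)| := by
      have := hF l hl
      exact_mod_cast Int.add_one_le_iff.2 this
    have h2 : |mesh * l - ξ| < R := by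
      rw [abs_sub_lt_iff]
      constructor <;> linarith [hξ.1, hξ.2]
    have h3 : |mesh * l| = mesh * |(l : ℝ)| := by rw [abs_mul, abs_of_pos hm]
    have h4 := abs_sub_abs_le_abs_sub (mesh * l) ξ
    have h5 : mesh * (L + 1) ≤ mesh * |(l : ℝ)| := by gcongr
    rw [mul_add] at h5
    linarith
  have hdisj : (F : Set ℤ).PairwiseDisjoint
      fun l : ℤ => Ioo (mesh * (l : ℝ) - R) (mesh * l + R) := by
    have key : ∀ l m : ℤ, l < m → Disjoint (Ioo (mesh * (l : ℝ) - R) (mesh * l + R))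
        (Ioo (mesh * (m : ℝ) - R) (mesh * m + R)) := by
      intro l m hlm
      rw [Set.disjoint_left]
      intro ξ h1 h2
      have h3 : (l : ℝ) + 1 ≤ m := by exact_mod_cast hlm
      have h4 := mul_le_mul_of_nonneg_left h3 hm.le
      have h5 := h1.2
      have h6 := h2.1
      rw [mul_add] at h4
      linarith
    intro l _ m _ hlm
    rcases lt_or_gt_of_ne hlm with h | h
    · exact key l m h
    · exact (key m l h).symm
  have h1 : ENNReal.ofReal (Real.pi / 8) * ∑ l ∈ F, ‖gaborTransform f (x, mesh * l)‖ₑ ^ 2 ≤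
      ENNReal.ofReal (Real.exp (Real.pi / 8)) *
        (ENNReal.ofReal mesh * kappa (mesh * L) f ^ 2) := by
    rw [Finset.mul_sum]
    calc _ ≤ ∑ l ∈ F, ENNReal.ofReal (Real.exp (Real.pi / 8)) *
          ∫⁻ y in Ioo (x - R) (x + R), ∫⁻ ξ in Ioo (mesh * (l : ℝ) - R) (mesh * l + R),
            ‖gaborTransform f (y, ξ)‖ₑ ^ 2 := by
          refine Finset.sum_le_sum fun l _ => ?_
          rw [← hR2]
          exact pi_mul_sq_gaborTransform_le f x (mesh * l) (by positivity)
      _ = ENNReal.ofReal (Real.exp (Real.pi / 8)) * ∫⁻ y in Ioo (x - R) (x + R), ∑ l ∈ F,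
          ∫⁻ ξ in Ioo (mesh * (l : ℝ) - R) (mesh * l + R), ‖gaborTransform f (y, ξ)‖ₑ ^ 2 := by
          rw [← Finset.mul_sum, lintegral_finsetSum]
          intro l _
          exact Measurable.lintegral_prod_right' (f := fun p => ‖gaborTransform f p‖ₑ ^ 2)
            (hcont.enorm.measurable.pow_const 2)
      _ ≤ ENNReal.ofReal (Real.exp (Real.pi / 8)) *
          ∫⁻ y in Ioo (x - R) (x + R), kappa (mesh * L) f ^ 2 := by
          gcongr with y
          rw [← lintegral_biUnion_finset hdisj (fun l _ => measurableSet_Ioo)]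
          refine le_trans (lintegral_mono_set ?_)
            (setLIntegral_sq_gaborTransform_le_kappa (mesh * L) f y)
          exact iUnion₂_subset fun l hl ξ hξ => hint l hl ξ hξ
      _ = _ := by
          rw [setLIntegral_const, Real.volume_Ioo, mul_comm (kappa _ _ ^ 2)]
          congr 3
          rw [hR]
          ring
  have hπ := Real.pi_pos
  -- From `e^{-x} ≥ 1 - x` at `x = π/8`, where `x(1 - x)` is about `0.238`.
  have h2 : (23 / 100 : ℝ) ≤ Real.exp (-(Real.pi / 8)) * (Real.pi / 8) := by
    have h3 := Real.add_one_le_exp (-(Real.pi / 8))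
    have h4 := Real.pi_gt_d2
    have h5 := Real.pi_lt_d2
    nlinarith
  calc _ ≤ ENNReal.ofReal (Real.exp (-(Real.pi / 8)) * (Real.pi / 8)) *
        ∑ l ∈ F, ‖gaborTransform f (x, mesh * l)‖ₑ ^ 2 := by gcongr
    _ = ENNReal.ofReal (Real.exp (-(Real.pi / 8))) * (ENNReal.ofReal (Real.pi / 8) *
        ∑ l ∈ F, ‖gaborTransform f (x, mesh * l)‖ₑ ^ 2) := by
        rw [ENNReal.ofReal_mul (Real.exp_pos _).le, mul_assoc]
    _ ≤ ENNReal.ofReal (Real.exp (-(Real.pi / 8))) * (ENNReal.ofReal (Real.exp (Real.pi / 8)) *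
        (ENNReal.ofReal mesh * kappa (mesh * L) f ^ 2)) := by gcongr
    _ = _ := by
        rw [← mul_assoc, ← ENNReal.ofReal_mul (Real.exp_pos _).le, ← Real.exp_add,
          neg_add_cancel, Real.exp_zero, ENNReal.ofReal_one, one_mul]

theorem sum_sq_gaborTransform_le (f : L2) (x : ℝ) (L : ℕ) (F : Finset ℤ)
    (hF : ∀ l ∈ F, (L : ℤ) < |l|) (hκ : kappa (mesh * L) f ≠ ∞) :
    ∑ l ∈ F, ‖gaborTransform f (x, mesh * l)‖ ^ 2 ≤
      100 / 23 * (mesh * (kappa (mesh * L) f).toReal ^ 2) := by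
  have h := sum_enorm_sq_gaborTransform_le f x L F hF
  have e : ∑ l ∈ F, ‖gaborTransform f (x, mesh * l)‖ₑ ^ 2 =
      ENNReal.ofReal (∑ l ∈ F, ‖gaborTransform f (x, mesh * l)‖ ^ 2) := by
    rw [ENNReal.ofReal_sum_of_nonneg fun _ _ => sq_nonneg _]
    refine Finset.sum_congr rfl fun l _ => ?_
    rw [ENNReal.ofReal_pow (norm_nonneg _), ofReal_norm]
  rw [e, ← ENNReal.ofReal_toReal hκ, ← ENNReal.ofReal_pow ENNReal.toReal_nonneg,
    ← ENNReal.ofReal_mul (by norm_num), ← ENNReal.ofReal_mul mesh_pos.le,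
    ENNReal.ofReal_le_ofReal_iff (mul_nonneg mesh_pos.le (sq_nonneg _))] at h
  linarith

/-! ### Gabor coefficients on a vertical line -/

theorem two_rpow_quarter_le : (2 : ℝ) ^ (1 / 4 : ℝ) ≤ 6 / 5 := by
  have h : ((6 / 5 : ℝ) ^ (4 : ℝ)) ^ (1 / 4 : ℝ) = 6 / 5 := by
    rw [← Real.rpow_mul (by norm_num)]
    norm_num
  rw [← h]
  refine Real.rpow_le_rpow (by norm_num) ?_ (by norm_num)
  rw [show (4 : ℝ) = ((4 : ℕ) : ℝ) by norm_num, Real.rpow_natCast]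
  norm_num

theorem gaussianFun_le (t : ℝ) : gaussianFun t ≤ 6 / 5 := by
  unfold gaussianFun
  have h : Real.exp (-Real.pi * t ^ 2) ≤ 1 := by
    rw [Real.exp_le_one_iff]
    nlinarith [Real.pi_pos, sq_nonneg t]
  calc _ ≤ (6 / 5 : ℝ) * 1 := mul_le_mul two_rpow_quarter_le h (Real.exp_pos _).le (by norm_num)
    _ = _ := mul_one _

theorem memLp_sqrt_gaussianFun : MemLp (fun t : ℝ => (√(gaussianFun t) : ℂ)) 2 volume := by
  have hc : Continuous fun t : ℝ => (√(gaussianFun t) : ℂ) := by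
    have := contDiff_gaussianFun.continuous
    fun_prop
  rw [memLp_two_iff_integrable_sq_norm hc.aestronglyMeasurable]
  refine ((integrable_exp_neg_mul_sq Real.pi_pos).const_mul ((2 : ℝ) ^ (1 / 4 : ℝ))).congr
    (Filter.Eventually.of_forall fun t => ?_)
  simp only [Complex.norm_real, Real.norm_eq_abs, sq_abs, Real.sq_sqrt (gaussianFun_pos t).le]
  rfl

/-- The square root of the Gaussian, as an element of `L²(ℝ)`. -/
def sqrtGaussian : L2 := memLp_sqrt_gaussianFun.toLp _

/-- The translated square root of the Gaussian, as a multiplier. -/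
def sqrtGaussianMultiplier (x : ℝ) : BoundedContinuousFunction ℝ ℂ :=
  BoundedContinuousFunction.ofNormedAddCommGroup (fun t : ℝ => (√(gaussianFun (t - x)) : ℂ))
    (by
      have := contDiff_gaussianFun.continuous
      fun_prop)
    (√(6 / 5)) fun t => by
      rw [Complex.norm_real, Real.norm_of_nonneg (Real.sqrt_nonneg _)]
      exact Real.sqrt_le_sqrt (gaussianFun_le _)

theorem coeFn_tfShift_sqrtGaussian (p : ℝ × ℝ) :
    tfShift p sqrtGaussian =ᵐ[volume]
      fun t => Complex.exp (2 * Real.pi * Complex.I * p.2 * t) * (√(gaussianFun (t - p.1)) : ℂ) := by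
  filter_upwards [coeFn_tfShift p sqrtGaussian,
    ae_eq_comp_sub memLp_sqrt_gaussianFun.coeFn_toLp p.1] with t h1 h2
  rw [h1]
  exact congrArg _ h2

theorem ofReal_sqrt_mul_sqrt {y : ℝ} (hy : 0 ≤ y) : ((√y : ℝ) : ℂ) * ((√y : ℝ) : ℂ) = y := by
  rw [← Complex.ofReal_mul, Real.mul_self_sqrt hy]

theorem norm_inner_tfShift_sqrtGaussian (x ω ξ : ℝ) :
    ‖inner ℂ (tfShift (x, ω) sqrtGaussian) (tfShift (x, ξ) sqrtGaussian)‖ =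
      2 ^ (1 / 4 : ℝ) * Real.exp (-Real.pi * (ω - ξ) ^ 2) := by
  rw [L2.inner_def]
  have e : (fun t => inner ℂ (tfShift (x, ω) sqrtGaussian t) (tfShift (x, ξ) sqrtGaussian t))
      =ᵐ[volume] fun t => (((2 : ℝ) ^ (1 / 4 : ℝ) : ℝ) : ℂ) *
        (Complex.exp (2 * Real.pi * Complex.I * ((ξ - ω : ℝ) : ℂ) * t) *
          (Real.exp (-Real.pi * 1 * (t - x) ^ 2) : ℂ)) := by
    filter_upwards [coeFn_tfShift_sqrtGaussian (x, ω), coeFn_tfShift_sqrtGaussian (x, ξ)]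
      with t h1 h2
    have h3 : Complex.exp (2 * Real.pi * Complex.I * ((ξ - ω : ℝ) : ℂ) * t) =
        Complex.exp (2 * Real.pi * Complex.I * ξ * t) *
          (starRingEnd ℂ) (Complex.exp (2 * Real.pi * Complex.I * ω * t)) := by
      rw [← Complex.exp_conj, ← Complex.exp_add]
      congr 1
      simp only [map_mul, Complex.conj_ofReal, Complex.conj_I, map_ofNat]
      push_cast
      ring
    rw [h1, h2, RCLike.inner_apply, h3, map_mul, Complex.conj_ofReal]
    have h4 := ofReal_sqrt_mul_sqrt (gaussianFun_pos (t - x)).le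
    have h5 : (gaussianFun (t - x) : ℂ) = (((2 : ℝ) ^ (1 / 4 : ℝ) : ℝ) : ℂ) *
        (Real.exp (-Real.pi * 1 * (t - x) ^ 2) : ℂ) := by
      rw [gaussianFun, mul_one, Complex.ofReal_mul]
    rw [h5] at h4
    linear_combination (Complex.exp (2 * Real.pi * Complex.I * ξ * t) *
          (starRingEnd ℂ) (Complex.exp (2 * Real.pi * Complex.I * ω * t))) * h4
  rw [integral_congr_ae e, integral_const_mul, norm_mul,
    norm_integral_gaussian_mul_character one_pos, Complex.norm_real,
    Real.norm_of_nonneg (by positivity), Real.sqrt_one, inv_one, one_mul, mul_one]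
  congr 2
  ring

/-- Schur's test on one vertical line; the parameter `1/2` is `mesh²`, and `1.2 · 1.43 ≤ 7/4`. -/
theorem isBessel_tfShift_sqrtGaussian (x : ℝ) :
    IsBessel (7 / 4) fun l : ℤ => tfShift (x, mesh * l) sqrtGaussian := by
  refine isBessel_of_gram (m := fun l m : ℤ => ‖inner ℂ (tfShift (x, mesh * l) sqrtGaussian)
    (tfShift (x, mesh * m) sqrtGaussian)‖)
    (fun _ _ => norm_inner_symm _ _) (fun _ _ => norm_nonneg _) (fun _ _ => le_rfl)
    fun s l => ?_
  have e : ∀ m : ℤ, Real.exp (-Real.pi * (mesh * l - mesh * m) ^ 2) =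
      Real.exp (-Real.pi * (1 / 2) * ((l : ℝ) - m) ^ 2) := by
    intro m
    rw [← mul_sub, mul_pow, mesh_sq]
    ring_nf
  simp_rw [norm_inner_tfShift_sqrtGaussian, e]
  rw [← Finset.mul_sum]
  have h := (sum_exp_le_periodizedGaussian (by norm_num : (0 : ℝ) < 1 / 2) l s).trans
    (periodizedGaussian_half_le l)
  calc _ ≤ (6 / 5 : ℝ) * (143 / 100) := mul_le_mul two_rpow_quarter_le h
        (Finset.sum_nonneg fun _ _ => (Real.exp_pos _).le) (by norm_num)
    _ ≤ _ := by norm_num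

/-- One square root of the window is moved onto `f`, producing the local norm in `eta`; the other
remains as a window with a Bessel bound of its own. -/
theorem inner_tfShift_gaussian_eq_sqrt (f : L2) (x ω : ℝ) :
    inner ℂ (tfShift (x, ω) gaussian) f =
      inner ℂ (tfShift (x, ω) sqrtGaussian) (mulOp (sqrtGaussianMultiplier x) f) := by
  rw [L2.inner_def, L2.inner_def]
  refine integral_congr_ae ?_
  filter_upwards [coeFn_tfShift_gaussian (x, ω), coeFn_tfShift_sqrtGaussian (x, ω),
    coeFn_mulOp (sqrtGaussianMultiplier x) f] with t h1 h2 h3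
  have h4 := ofReal_sqrt_mul_sqrt (gaussianFun_pos (t - x)).le
  have h5 : sqrtGaussianMultiplier x t = (√(gaussianFun (t - x)) : ℂ) := rfl
  rw [h1, h2, h3, h5, RCLike.inner_apply, RCLike.inner_apply, map_mul, map_mul,
    Complex.conj_ofReal, Complex.conj_ofReal, ← h4]
  ring

theorem norm_mulOp_sqrtGaussianMultiplier_le (f : L2) (x : ℝ) (hη : eta f ≠ ∞) :
    ‖mulOp (sqrtGaussianMultiplier x) f‖ ≤ (eta f).toReal := by
  rw [Lp.norm_def]
  refine ENNReal.toReal_mono hη ?_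
  refine le_trans (le_of_eq ?_) (le_iSup (fun x : ℝ =>
    eLpNorm (fun t => f t * (√(gaussianFun (t - x)) : ℂ)) 2 volume) x)
  refine eLpNorm_congr_ae ?_
  filter_upwards [coeFn_mulOp (sqrtGaussianMultiplier x) f] with t h
  rw [h, mul_comm]
  rfl

theorem sum_sq_inner_gaborAtom_le_eta (f : L2) (k : ℤ) (hη : eta f ≠ ∞) (F : Finset ℤ) :
    ∑ l ∈ F, ‖inner ℂ (gaborAtom (k, l)) f‖ ^ 2 ≤ 7 / 4 * (eta f).toReal ^ 2 := by
  have h := (isBessel_tfShift_sqrtGaussian (mesh * k)).sum_sq_inner_le (by norm_num) F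
    (mulOp (sqrtGaussianMultiplier (mesh * k)) f)
  simp_rw [← inner_tfShift_gaussian_eq_sqrt] at h
  refine h.trans ?_
  gcongr
  exact norm_mulOp_sqrtGaussianMultiplier_le f _ hη

/-! ### Trigonometric polynomials -/

/-- The trigonometric polynomial with frequencies in `𝔞ℤ`. -/
def trigPoly (F : Finset ℤ) (d : ℤ → ℂ) (t : ℝ) : ℂ :=
  ∑ l ∈ F, d l * Complex.exp (2 * Real.pi * Complex.I * ((mesh * l : ℝ) : ℂ) * t)

theorem continuous_trigPoly (F : Finset ℤ) (d : ℤ → ℂ) : Continuous (trigPoly F d) := by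
  unfold trigPoly
  fun_prop

theorem trigPoly_sub_sqrt_two_mul (F : Finset ℤ) (d : ℤ → ℂ) (t : ℝ) (j : ℤ) :
    trigPoly F d (t - √2 * j) = trigPoly F d t := by
  unfold trigPoly
  refine Finset.sum_congr rfl fun l _ => ?_
  have := character_sub_sqrt_two_mul t l j
  rw [character_apply, character_apply] at this
  rw [this]

theorem integral_exp_periods (a : ℝ) (n : ℕ) (m : ℤ) :
    ∫ t in a..(a + √2 * n), Complex.exp (2 * Real.pi * Complex.I * ((mesh * m : ℝ) : ℂ) * t) =
      if m = 0 then ((√2 * n : ℝ) : ℂ) else 0 := by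
  split_ifs with hm
  · subst hm
    simp
  · have hc : (2 * Real.pi * Complex.I * ((mesh * m : ℝ) : ℂ) : ℂ) ≠ 0 := by
      have h1 : ((mesh * m : ℝ) : ℂ) ≠ 0 := by
        rw [Complex.ofReal_ne_zero]
        exact mul_ne_zero mesh_pos.ne' (by exact_mod_cast hm)
      exact mul_ne_zero Complex.two_pi_I_ne_zero h1
    rw [integral_exp_mul_complex hc]
    have h := character_sub_sqrt_two_mul a m (-n)
    rw [character_apply, character_apply] at h
    have e : a - √2 * ((-n : ℤ) : ℝ) = a + √2 * n := by
      push_cast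
      ring
    rw [e] at h
    rw [h, sub_self, zero_div]

theorem integral_norm_sq_trigPoly (F : Finset ℤ) (d : ℤ → ℂ) (a : ℝ) (n : ℕ) :
    ∫ t in a..(a + √2 * n), ‖trigPoly F d t‖ ^ 2 = √2 * n * ∑ l ∈ F, ‖d l‖ ^ 2 := by
  have hC : ((∫ t in a..(a + √2 * n), ‖trigPoly F d t‖ ^ 2 : ℝ) : ℂ) =
      ((√2 * n * ∑ l ∈ F, ‖d l‖ ^ 2 : ℝ) : ℂ) := by
    rw [← intervalIntegral.integral_ofReal]
    have e : ∀ t : ℝ, ((‖trigPoly F d t‖ ^ 2 : ℝ) : ℂ) = ∑ l ∈ F, ∑ m ∈ F,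
        d l * (starRingEnd ℂ) (d m) *
          Complex.exp (2 * Real.pi * Complex.I * ((mesh * (l - m : ℤ) : ℝ) : ℂ) * t) := by
      intro t
      rw [Complex.ofReal_pow, ← Complex.mul_conj', trigPoly, map_sum, Finset.sum_mul_sum]
      refine Finset.sum_congr rfl fun l _ => Finset.sum_congr rfl fun m _ => ?_
      have h3 : Complex.exp (2 * Real.pi * Complex.I * ((mesh * (l - m : ℤ) : ℝ) : ℂ) * t) =
          Complex.exp (2 * Real.pi * Complex.I * ((mesh * l : ℝ) : ℂ) * t) *
            (starRingEnd ℂ) (Complex.exp (2 * Real.pi * Complex.I * ((mesh * m : ℝ) : ℂ) * t)) := by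
        rw [← Complex.exp_conj, ← Complex.exp_add]
        congr 1
        simp only [map_mul, Complex.conj_ofReal, Complex.conj_I, map_ofNat]
        push_cast
        ring
      rw [h3, map_mul]
      ring
    simp_rw [e]
    rw [intervalIntegral.integral_finsetSum fun l _ =>
      Continuous.intervalIntegrable (by fun_prop) _ _]
    have e2 : ∀ l ∈ F, ∫ t in a..(a + √2 * n), ∑ m ∈ F, d l * (starRingEnd ℂ) (d m) *
          Complex.exp (2 * Real.pi * Complex.I * ((mesh * (l - m : ℤ) : ℝ) : ℂ) * t) =
        ((√2 * n : ℝ) : ℂ) * (‖d l‖ ^ 2 : ℝ) := by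
      intro l hl
      rw [intervalIntegral.integral_finsetSum fun m _ =>
        Continuous.intervalIntegrable (by fun_prop) _ _]
      simp_rw [intervalIntegral.integral_const_mul, integral_exp_periods]
      rw [Finset.sum_eq_single_of_mem l hl fun m _ hm => by
        rw [if_neg (sub_ne_zero.2 hm.symm), mul_zero]]
      rw [sub_self, if_pos rfl, Complex.mul_conj', Complex.ofReal_pow]
      ring
    rw [Finset.sum_congr rfl e2, ← Finset.mul_sum]
    push_cast
    ring
  exact_mod_cast hC

theorem setIntegral_norm_sq_trigPoly_le (F : Finset ℤ) (d : ℤ → ℂ) {τ : ℝ} (hτ : 0 < τ) :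
    ∫ t in Ioo (-τ) τ, ‖trigPoly F d t‖ ^ 2 ≤ 2 * (τ + 1) * ∑ l ∈ F, ‖d l‖ ^ 2 := by
  have h2 : √2 * √2 = 2 := Real.mul_self_sqrt zero_le_two
  have hs : √2 ≤ 3 / 2 := by
    rw [Real.sqrt_le_left (by norm_num)]
    norm_num
  have hs0 : 0 < √2 := by positivity
  -- This is the least number of full periods `√2` covering an interval of length `2τ`; rounding up
  -- costs at most one period, so the total length is at most `2(τ + 1)`.
  set n := ⌈√2 * τ⌉₊ with hn
  have hn1 : √2 * τ ≤ n := Nat.le_ceil _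
  have hn2 : (n : ℝ) < √2 * τ + 1 := Nat.ceil_lt_add_one (by positivity)
  have h3 : 2 * τ ≤ √2 * n := by nlinarith
  have h4 : √2 * n ≤ 2 * (τ + 1) := by nlinarith
  have hcont : Continuous fun t => ‖trigPoly F d t‖ ^ 2 := (continuous_trigPoly F d).norm.pow 2
  have h5 : ∫ t in Ioo (-τ) τ, ‖trigPoly F d t‖ ^ 2 ≤
      ∫ t in Ioc (-τ) (-τ + √2 * n), ‖trigPoly F d t‖ ^ 2 := by
    refine setIntegral_mono_set ?_ (Filter.Eventually.of_forall fun t => sq_nonneg _)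
      (Filter.Eventually.of_forall fun t ht => ?_)
    · exact (hcont.integrableOn_Icc).mono_set Ioc_subset_Icc_self
    · exact ⟨ht.1, by linarith [ht.2]⟩
  rw [← intervalIntegral.integral_of_le (by linarith), integral_norm_sq_trigPoly] at h5
  refine h5.trans ?_
  gcongr

/-! ### Off-diagonal decay of the inverse frame operator -/

/-- A shift by `√2 * j` costs `e^{-π|j|}`, that is, rate `π/√2` per unit length, and the Gaussian
covers the remaining distance `v`. Half of `e^{-πv²}` pays for this; the other half equals
`e^{-π(mesh s - j)²}` and is kept to make the sum over `j` converge. -/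
theorem thetaInvCoeff_mul_gaussianFun_le (s : ℝ) (j : ℤ) :
    |thetaInvCoeff j| * gaussianFun (s - √2 * j) ≤
      33 / 25 * Real.exp (Real.pi / 4) * Real.exp (-(Real.pi / √2) * |s|) *
        Real.exp (-Real.pi * 1 * (mesh * s - j) ^ 2) := by
  have hπ := Real.pi_pos
  have h2 : √2 * √2 = 2 := Real.mul_self_sqrt zero_le_two
  have hms := mesh_mul_sqrt_two
  set v := s - √2 * j with hv
  have hdiv : Real.pi / √2 = Real.pi * mesh := by
    rw [mesh, mul_one_div]
  have h1 : |s| ≤ |v| + √2 * |(j : ℝ)| := by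
    calc |s| = |v + √2 * j| := by rw [hv, sub_add_cancel]
      _ ≤ |v| + |√2 * j| := abs_add_le _ _
      _ = _ := by rw [abs_mul, abs_of_nonneg (Real.sqrt_nonneg 2)]
  have h3 : mesh * |s| ≤ mesh * |v| + |(j : ℝ)| := by
    have := mul_le_mul_of_nonneg_left h1 mesh_pos.le
    have e : mesh * (|v| + √2 * |(j : ℝ)|) = mesh * |v| + |(j : ℝ)| := by
      linear_combination |(j : ℝ)| * hms
    linarith
  -- Completing the square; the constant `1/4` is the source of the factor `e^{π/4}`.
  have h4 : mesh * |v| ≤ v ^ 2 / 2 + 1 / 4 := by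
    have := sq_nonneg (mesh * |v| - 1 / 2)
    have e : (mesh * |v| - 1 / 2) ^ 2 = v ^ 2 / 2 - mesh * |v| + 1 / 4 := by
      rw [sub_sq, mul_pow, mesh_sq, sq_abs]
      ring
    linarith
  have h5 : (mesh * s - j) ^ 2 = v ^ 2 / 2 := by
    have : mesh * s - j = mesh * v := by
      rw [hv]
      linear_combination (j : ℝ) * hms
    rw [this, mul_pow, mesh_sq]
    ring
  have h6 : Real.exp (-Real.pi) ^ j.natAbs = Real.exp (-Real.pi * |(j : ℝ)|) := by
    rw [← Real.exp_nat_mul, Nat.cast_natAbs, Int.cast_abs, mul_comm]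
  have hq := abs_thetaInvCoeff_le j
  rw [h6] at hq
  have hg : gaussianFun v ≤ 6 / 5 * Real.exp (-Real.pi * v ^ 2) := by
    unfold gaussianFun
    gcongr
    exact two_rpow_quarter_le
  calc |thetaInvCoeff j| * gaussianFun v
      ≤ (11 / 10 * Real.exp (-Real.pi * |(j : ℝ)|)) * (6 / 5 * Real.exp (-Real.pi * v ^ 2)) :=
        mul_le_mul hq hg (gaussianFun_pos v).le (by positivity)
    _ = 33 / 25 * Real.exp (-Real.pi * |(j : ℝ)| + -Real.pi * v ^ 2) := by
        rw [Real.exp_add]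
        ring
    _ ≤ 33 / 25 * Real.exp (Real.pi / 4 + -(Real.pi / √2) * |s| +
          -Real.pi * 1 * (mesh * s - j) ^ 2) := by
        refine mul_le_mul_of_nonneg_left (Real.exp_le_exp.2 ?_) (by norm_num)
        rw [hdiv, h5]
        nlinarith
    _ = _ := by
        rw [Real.exp_add, Real.exp_add]
        ring

theorem summable_thetaInvCoeff_mul_gaussianFun (s : ℝ) :
    Summable fun j : ℤ => |thetaInvCoeff j| * gaussianFun (s - √2 * j) :=
  Summable.of_nonneg_of_le
    (fun _ => mul_nonneg (abs_nonneg _) (gaussianFun_pos _).le)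
    (thetaInvCoeff_mul_gaussianFun_le s)
    ((summable_exp_neg_pi_mul_sq one_pos (mesh * s)).mul_left _)

theorem tsum_thetaInvCoeff_mul_gaussianFun_le (s : ℝ) :
    ∑' j : ℤ, |thetaInvCoeff j| * gaussianFun (s - √2 * j) ≤
      4 * Real.exp (-(Real.pi / √2) * |s|) := by
  have hsum := summable_exp_neg_pi_mul_sq one_pos (mesh * s)
  refine ((summable_thetaInvCoeff_mul_gaussianFun s).tsum_le_tsum
    (thetaInvCoeff_mul_gaussianFun_le s) (hsum.mul_left _)).trans ?_
  rw [tsum_mul_left]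
  have h1 : ∑' j : ℤ, Real.exp (-Real.pi * 1 * (mesh * s - j) ^ 2) ≤ 21 / 19 :=
    periodizedGaussian_one_le (mesh * s)
  have h2 : Real.exp (Real.pi / 4) ≤ 272 / 100 := by
    have h3 : Real.exp (Real.pi / 4) ≤ Real.exp 1 :=
      Real.exp_le_exp.2 (by linarith [Real.pi_le_four])
    linarith [Real.exp_one_lt_d9]
  have h0 : 0 ≤ ∑' j : ℤ, Real.exp (-Real.pi * 1 * (mesh * s - j) ^ 2) :=
    tsum_nonneg fun _ => (Real.exp_pos _).le
  have hE := Real.exp_pos (-(Real.pi / √2) * |s|)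
  calc _ ≤ 33 / 25 * (272 / 100) * Real.exp (-(Real.pi / √2) * |s|) * (21 / 19) := by gcongr
    _ ≤ _ := by nlinarith

theorem coeFn_sum_smul_gaborAtom (k : ℤ) (F : Finset ℤ) (d : ℤ → ℂ) :
    (∑ l ∈ F, d l • gaborAtom (k, l) : L2) =ᵐ[volume]
      fun t => trigPoly F d t * gaussianFun (t - mesh * k) := by
  have hae : ∀ᵐ t, ∀ l : ℤ, (d l • gaborAtom (k, l) : L2) t =
      d l * (Complex.exp (2 * Real.pi * Complex.I * ((mesh * l : ℝ) : ℂ) * t) *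
        gaussianFun (t - mesh * k)) := by
    refine ae_all_iff.2 fun l => ?_
    filter_upwards [Lp.coeFn_smul (d l) (gaborAtom (k, l)),
      coeFn_tfShift_gaussian (mesh * k, mesh * l)] with t h1 h2
    rw [h1, Pi.smul_apply, smul_eq_mul, gaborAtom, h2]
  filter_upwards [coeFn_finsetSum (fun l => d l • gaborAtom (k, l)) F, hae] with t h1 h2
  rw [h1, trigPoly, Finset.sum_mul]
  exact Finset.sum_congr rfl fun l _ => (h2 l).trans (mul_assoc _ _ _).symm

/-- The trigonometric polynomial is `√2`-periodic and so factors out of the convolution, which acts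
on the Gaussian alone. The constant is `4 · 19/34 ≤ 9/4`. -/
theorem ae_norm_frameInv_sum_le (k : ℤ) (F : Finset ℤ) (d : ℤ → ℂ) :
    ∀ᵐ t, ‖frameInv (∑ l ∈ F, d l • gaborAtom (k, l)) t‖ ≤
      9 / 4 * Real.exp (-(Real.pi / √2) * |t - mesh * k|) * ‖trigPoly F d t‖ := by
  set u : L2 := ∑ l ∈ F, d l • gaborAtom (k, l) with hu
  have hseries : shiftSeries thetaInvCoeff u =ᵐ[volume] fun t => ∑' j : ℤ,
      (thetaInvCoeff j : ℂ) * (trigPoly F d t * gaussianFun (t - mesh * k - √2 * j)) := by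
    refine ae_eq_of_hasSum (hasSum_shiftSeries summable_abs_thetaInvCoeff u) ?_
    have hae : ∀ᵐ t, ∀ j : ℤ, ((thetaInvCoeff j : ℂ) • translation (√2 * j) u : L2) t =
        (thetaInvCoeff j : ℂ) * (trigPoly F d t * gaussianFun (t - mesh * k - √2 * j)) := by
      refine ae_all_iff.2 fun j => ?_
      filter_upwards [Lp.coeFn_smul (thetaInvCoeff j : ℂ) (translation (√2 * j) u),
        coeFn_translation (√2 * j) u,
        ae_eq_comp_sub (coeFn_sum_smul_gaborAtom k F d) (√2 * j)] with t h1 h2 h3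
      rw [h1, Pi.smul_apply, smul_eq_mul, h2, h3, trigPoly_sub_sqrt_two_mul, sub_right_comm]
    filter_upwards [hae] with t ht
    simp_rw [ht]
    refine Summable.hasSum (Summable.of_norm ?_)
    refine ((summable_thetaInvCoeff_mul_gaussianFun (t - mesh * k)).mul_left
      ‖trigPoly F d t‖).congr fun j => ?_
    rw [norm_mul, norm_mul, Complex.norm_real, Complex.norm_real, Real.norm_eq_abs,
      Real.norm_of_nonneg (gaussianFun_pos _).le]
    ring
  have e : frameInv u = mulOp weightInv (shiftSeries thetaInvCoeff u) := rfl
  rw [e]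
  filter_upwards [coeFn_mulOp weightInv (shiftSeries thetaInvCoeff u), hseries] with t h1 h2
  rw [h1, h2, norm_mul]
  have hs := summable_thetaInvCoeff_mul_gaussianFun (t - mesh * k)
  have h3 : ‖∑' j : ℤ, (thetaInvCoeff j : ℂ) *
      (trigPoly F d t * gaussianFun (t - mesh * k - √2 * j))‖ ≤
      ‖trigPoly F d t‖ * (4 * Real.exp (-(Real.pi / √2) * |t - mesh * k|)) := by
    refine (tsum_of_norm_bounded (hs.hasSum.mul_left ‖trigPoly F d t‖) fun j => le_of_eq ?_).trans
      (mul_le_mul_of_nonneg_left (tsum_thetaInvCoeff_mul_gaussianFun_le _) (norm_nonneg _))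
    rw [norm_mul, norm_mul, Complex.norm_real, Complex.norm_real, Real.norm_eq_abs,
      Real.norm_of_nonneg (gaussianFun_pos _).le]
    ring
  have h4 : ‖weightInv t‖ ≤ 19 / 34 := norm_weight_inv_le t
  have h5 : 0 ≤ ‖trigPoly F d t‖ * Real.exp (-(Real.pi / √2) * |t - mesh * k|) := by positivity
  calc _ ≤ 19 / 34 * (‖trigPoly F d t‖ * (4 * Real.exp (-(Real.pi / √2) * |t - mesh * k|))) :=
        mul_le_mul h4 h3 (norm_nonneg _) (by norm_num)
    _ ≤ _ := by nlinarith

/-! ### Restriction to an interval -/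

/-- Restriction of an element of `L²(ℝ)` to the interval `(-τ, τ)`. -/
def restrictL2 (τ : ℝ) : L2 →L[ℂ] Lp ℂ 2 (volume.restrict (Ioo (-τ) τ)) :=
  LpToLpRestrictCLM ℝ ℂ ℂ volume 2 (Ioo (-τ) τ)

theorem eLpNorm_restrict_eq (τ : ℝ) (h : L2) :
    eLpNorm h 2 (volume.restrict (Ioo (-τ) τ)) = ENNReal.ofReal ‖restrictL2 τ h‖ := by
  rw [Lp.norm_def, ENNReal.ofReal_toReal (Lp.eLpNorm_ne_top _)]
  exact eLpNorm_congr_ae (LpToLpRestrictCLM_coeFn ℂ (Ioo (-τ) τ) h).symm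

theorem norm_restrictL2_le (τ : ℝ) (h : L2) : ‖restrictL2 τ h‖ ≤ ‖h‖ := by
  rw [← ENNReal.ofReal_le_ofReal_iff (norm_nonneg _), ← eLpNorm_restrict_eq, Lp.norm_def h,
    ENNReal.ofReal_toReal (Lp.eLpNorm_ne_top _)]
  exact eLpNorm_mono_measure _ Measure.restrict_le_self

theorem norm_restrictL2_sq (τ : ℝ) (h : L2) :
    ‖restrictL2 τ h‖ ^ 2 = ∫ t in Ioo (-τ) τ, ‖h t‖ ^ 2 := by
  have h1 : ‖restrictL2 τ h‖ ^ 2 =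
      ∫ t in Ioo (-τ) τ, ‖restrictL2 τ h t‖ ^ 2 := by
    have h2 := L2.inner_def (𝕜 := ℂ) (restrictL2 τ h) (restrictL2 τ h)
    simp only [inner_self_eq_norm_sq_to_K] at h2
    have h3 : ((‖restrictL2 τ h‖ ^ 2 : ℝ) : ℂ) =
        ((∫ t in Ioo (-τ) τ, ‖restrictL2 τ h t‖ ^ 2 : ℝ) : ℂ) := by
      rw [← integral_complex_ofReal]
      push_cast
      exact h2
    exact_mod_cast h3
  rw [h1]
  refine integral_congr_ae ?_
  filter_upwards [LpToLpRestrictCLM_coeFn ℂ (Ioo (-τ) τ) h] with t ht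
  exact congrArg (fun z : ℂ => ‖z‖ ^ 2) ht

theorem norm_restrictL2_frameInv_sum_le {τ : ℝ} (hτ : 0 < τ) (k : ℤ) (F : Finset ℤ)
    (d : ℤ → ℂ) :
    ‖restrictL2 τ (frameInv (∑ l ∈ F, d l • gaborAtom (k, l)))‖ ^ 2 ≤
      (9 / 4 * Real.exp (-(Real.pi / √2) * (mesh * |(k : ℝ)| - τ))) ^ 2 *
        (2 * (τ + 1) * ∑ l ∈ F, ‖d l‖ ^ 2) := by
  rw [norm_restrictL2_sq]
  have hπ := Real.pi_pos
  have hcont : Continuous fun t => ‖trigPoly F d t‖ ^ 2 := (continuous_trigPoly F d).norm.pow 2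
  calc _ ≤ ∫ t in Ioo (-τ) τ,
        (9 / 4 * Real.exp (-(Real.pi / √2) * (mesh * |(k : ℝ)| - τ))) ^ 2 *
          ‖trigPoly F d t‖ ^ 2 := by
        refine integral_mono_of_nonneg (Filter.Eventually.of_forall fun t => sq_nonneg _)
          (((hcont.integrableOn_Icc (a := -τ) (b := τ)).mono_set Ioo_subset_Icc_self).const_mul _)
          ?_
        filter_upwards [ae_restrict_of_ae (ae_norm_frameInv_sum_le k F d),
          ae_restrict_mem measurableSet_Ioo] with t h1 ht
        rw [← mul_pow]
        refine pow_le_pow_left₀ (norm_nonneg _) (h1.trans ?_) 2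
        have h2 : mesh * |(k : ℝ)| - τ ≤ |t - mesh * k| := by
          have h3 := abs_sub_abs_le_abs_sub (mesh * k) t
          have h4 : |t| < τ := abs_lt.2 ht
          rw [abs_mul, abs_of_pos mesh_pos, abs_sub_comm] at h3
          linarith
        gcongr 9 / 4 * Real.exp ?_ * _
        have h5 : 0 ≤ Real.pi / √2 := by positivity
        nlinarith
    _ = (9 / 4 * Real.exp (-(Real.pi / √2) * (mesh * |(k : ℝ)| - τ))) ^ 2 *
          ∫ t in Ioo (-τ) τ, ‖trigPoly F d t‖ ^ 2 := integral_const_mul _ _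
    _ ≤ _ := by
        gcongr
        exact setIntegral_norm_sq_trigPoly_le F d hτ

theorem norm_restrictL2_frameInv_tsum_le {τ : ℝ} (hτ : 0 < τ) (k : ℤ) (f : L2)
    (hη : eta f ≠ ∞) :
    ‖restrictL2 τ (frameInv (∑' l : ℤ, inner ℂ (gaborAtom (k, l)) f • gaborAtom (k, l)))‖ ≤
      17 / 4 * √(τ + 1) * (eta f).toReal *
        Real.exp (-(Real.pi / √2) * (mesh * |(k : ℝ)| - τ)) := by
  have hsum := ((isBessel_gaborAtom.summable_inner_smul (by norm_num) f).prod_factor k).hasSum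
  have hlim := (hsum.mapL frameInv).mapL (restrictL2 τ)
  refine le_of_tendsto' hlim.norm fun F => ?_
  rw [← map_sum, ← map_sum]
  set E := Real.exp (-(Real.pi / √2) * (mesh * |(k : ℝ)| - τ)) with hE
  have hE0 : 0 < E := Real.exp_pos _
  have hη0 : 0 ≤ (eta f).toReal := ENNReal.toReal_nonneg
  refine le_of_pow_le_pow_left₀ two_ne_zero (by positivity) ?_
  refine (norm_restrictL2_frameInv_sum_le hτ k F _).trans ?_
  calc _ ≤ (9 / 4 * E) ^ 2 * (2 * (τ + 1) * (7 / 4 * (eta f).toReal ^ 2)) := by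
        gcongr
        exact sum_sq_inner_gaborAtom_le_eta f k hη F
    _ = 567 / 32 * ((τ + 1) * ((eta f).toReal ^ 2 * E ^ 2)) := by ring
    -- Rounding `567/32` up to the square of `17/4`.
    _ ≤ 289 / 16 * ((τ + 1) * ((eta f).toReal ^ 2 * E ^ 2)) := by
        exact mul_le_mul_of_nonneg_right (by norm_num) (by positivity)
    _ = _ := by
        rw [mul_pow, mul_pow, mul_pow, Real.sq_sqrt (by linarith)]
        ring

/-! ### The three error terms -/

theorem hasSum_ite_pow_natAbs {r : ℝ} (h0 : 0 ≤ r) (h1 : r < 1) (K : ℕ) :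
    HasSum (fun k : ℤ => if K < k.natAbs then r ^ k.natAbs else 0)
      (2 * (r ^ (K + 1) / (1 - r))) := by
  have hg : HasSum (fun n : ℕ => r ^ (n + (K + 1))) (r ^ (K + 1) / (1 - r)) := by
    simpa [pow_add, div_eq_mul_inv, mul_comm] using
      (hasSum_geometric_of_lt_one h0 h1).mul_left (r ^ (K + 1))
  have hn : HasSum (fun n : ℕ => if K < n then r ^ n else 0) (r ^ (K + 1) / (1 - r)) := by
    rw [← hasSum_nat_add_iff' (K + 1), Finset.sum_eq_zero fun i hi => by
      rw [if_neg (by have := Finset.mem_range.1 hi; omega)], sub_zero]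
    refine hg.congr_fun fun n => ?_
    rw [if_pos (by omega)]
  have hm : HasSum (fun n : ℕ => if K < n + 1 then r ^ (n + 1) else 0)
      (r ^ (K + 1) / (1 - r)) := by
    -- Negative integers are indexed as `-(n + 1)`, so only `K` terms are dropped here, against `K +
    -- 1` on the other side.
    rw [← hasSum_nat_add_iff' K, Finset.sum_eq_zero fun i hi => by
      rw [if_neg (by have := Finset.mem_range.1 hi; omega)], sub_zero]
    refine hg.congr_fun fun n => ?_
    rw [if_pos (by omega), add_assoc]
  rw [two_mul]
  refine HasSum.of_nat_of_neg_add_one (f := fun k : ℤ => if K < k.natAbs then r ^ k.natAbs else 0)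
    (by simpa using hn) ?_
  refine hm.congr_fun fun n => ?_
  have : (-((n : ℤ) + 1)).natAbs = n + 1 := by omega
  rw [this]

theorem exp_neg_half_pi_le : Real.exp (-Real.pi / 2) ≤ 9 / 40 := by
  have h : Real.exp (-Real.pi / 2) ^ 2 = Real.exp (-Real.pi) := by
    rw [← Real.exp_nat_mul]
    congr 1
    push_cast
    ring
  refine le_of_pow_le_pow_left₀ two_ne_zero (by norm_num) ?_
  rw [h]
  exact exp_neg_pi_le.trans (by norm_num)

theorem norm_frameInv_tsum_le {d : ℤ × ℤ → ℂ} (hd : Summable fun z => ‖d z‖ ^ 2) {X : ℝ}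
    (hX : 0 ≤ X) (hdX : ∑' z, ‖d z‖ ^ 2 ≤ X ^ 2) :
    ‖frameInv (∑' z, d z • gaborAtom z)‖ ≤ 3 / 2 * X := by
  have h1 : ‖∑' z, d z • gaborAtom z‖ ≤ 201 / 100 * X := by
    refine le_of_pow_le_pow_left₀ two_ne_zero (by positivity) ?_
    refine (isBessel_gaborAtom.norm_tsum_sq_le (by norm_num) hd).trans ?_
    rw [mul_pow]
    gcongr
  calc _ ≤ ‖frameInv‖ * ‖∑' z, d z • gaborAtom z‖ := frameInv.le_opNorm _
    _ ≤ 7 / 10 * (201 / 100 * X) :=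
        mul_le_mul norm_frameInv_le h1 (norm_nonneg _) (by norm_num)
    _ ≤ _ := by linarith

/-- The lattice points of the box of half-widths `K` and `L`. -/
def indexBox (K L : ℕ) : Finset (ℤ × ℤ) := Finset.Icc (-K : ℤ) K ×ˢ Finset.Icc (-L : ℤ) L

theorem mem_indexBox {K L : ℕ} {z : ℤ × ℤ} :
    z ∈ indexBox K L ↔ z.1.natAbs ≤ K ∧ z.2.natAbs ≤ L := by
  simp only [indexBox, Finset.mem_product, Finset.mem_Icc]
  omega

/-- The coefficients at frequencies outside the box. -/
def frequencyTail (K L : ℕ) (f : L2) (z : ℤ × ℤ) : ℂ :=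
  if z.1.natAbs ≤ K ∧ L < z.2.natAbs then inner ℂ (gaborAtom z) f else 0

/-- The coefficients at times outside the box. -/
def timeTail (K : ℕ) (f : L2) (z : ℤ × ℤ) : ℂ :=
  if K < z.1.natAbs then inner ℂ (gaborAtom z) f else 0

/-- Each of the `2K + 1` columns contributes at most `(100/23) mesh κ²`; this count of columns is
the source of `√(T + 1)`. -/
theorem sum_sq_frequencyTail_le (K L : ℕ) (f : L2) (hκ : kappa (mesh * L) f ≠ ∞)
    (s : Finset (ℤ × ℤ)) :
    ∑ z ∈ s, ‖frequencyTail K L f z‖ ^ 2 ≤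
      (3 * (√(mesh * K + 1) * (kappa (mesh * L) f).toReal)) ^ 2 := by
  classical
  set κ := (kappa (mesh * L) f).toReal with hκdef
  have hm := mesh_pos
  have hm1 : mesh ≤ 1 := by
    have := mesh_sq
    nlinarith
  set F := (s.image Prod.snd).filter fun l => L < l.natAbs with hF
  have hline : ∀ k : ℤ, ∑ l ∈ F, ‖inner ℂ (gaborAtom (k, l)) f‖ ^ 2 ≤
      100 / 23 * (mesh * κ ^ 2) := fun k =>
    sum_sq_gaborTransform_le f (mesh * k) L F (fun l hl => by
      have := (Finset.mem_filter.1 hl).2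
      rw [Int.abs_eq_natAbs]
      exact_mod_cast this) hκ
  have h1 : ∑ z ∈ s, ‖frequencyTail K L f z‖ ^ 2 ≤
      ∑ z ∈ Finset.Icc (-K : ℤ) K ×ˢ F, ‖inner ℂ (gaborAtom z) f‖ ^ 2 := by
    have h2 : ∑ z ∈ s, ‖frequencyTail K L f z‖ ^ 2 =
        ∑ z ∈ s.filter (fun z => z.1.natAbs ≤ K ∧ L < z.2.natAbs),
          ‖inner ℂ (gaborAtom z) f‖ ^ 2 := by
      rw [Finset.sum_filter]
      refine Finset.sum_congr rfl fun z _ => ?_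
      unfold frequencyTail
      split_ifs <;> simp
    rw [h2]
    refine Finset.sum_le_sum_of_subset_of_nonneg (fun z hz => ?_) fun _ _ _ => sq_nonneg _
    obtain ⟨hz1, hz2, hz3⟩ := Finset.mem_filter.1 hz
    refine Finset.mem_product.2 ⟨Finset.mem_Icc.2 (by omega), ?_⟩
    exact Finset.mem_filter.2 ⟨Finset.mem_image_of_mem _ hz1, hz3⟩
  have hcard : ((Finset.Icc (-K : ℤ) K).card : ℝ) = 2 * K + 1 := by
    rw [Int.card_Icc]
    have : ((K : ℤ) + 1 - -K).toNat = 2 * K + 1 := by omega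
    rw [this]
    push_cast
    ring
  calc _ ≤ _ := h1
    _ = ∑ k ∈ Finset.Icc (-K : ℤ) K, ∑ l ∈ F, ‖inner ℂ (gaborAtom (k, l)) f‖ ^ 2 :=
        Finset.sum_product _ _ _
    _ ≤ ∑ k ∈ Finset.Icc (-K : ℤ) K, 100 / 23 * (mesh * κ ^ 2) :=
        Finset.sum_le_sum fun k _ => hline k
    _ = 100 / 23 * (2 * (mesh * K) + mesh) * κ ^ 2 := by
        rw [Finset.sum_const, nsmul_eq_mul, hcard]
        ring
    _ ≤ 9 * (mesh * K + 1) * κ ^ 2 := by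
        gcongr ?_ * _
        have : 0 ≤ mesh * K := by positivity
        linarith
    _ = _ := by
        rw [mul_pow, mul_pow, Real.sq_sqrt (by positivity)]
        ring

/-- The columns are added by the triangle inequality. Successive ones shrink by `r = e^{-π/2}`,
because `(π/√2) mesh = π/2`. The first column outside has index `K + 1`, and the spare factor `r`
improves the constant: `(17/2) · (9/31) ≤ 5/2`. -/
theorem norm_restrictL2_timeTail_le {τ : ℝ} (hτ : 0 < τ) (K : ℕ) (f : L2) (hη : eta f ≠ ∞)
    (hs : Summable fun z => timeTail K f z • gaborAtom z) :
    ‖restrictL2 τ (frameInv (∑' z, timeTail K f z • gaborAtom z))‖ ≤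
      5 / 2 * (√(τ + 1) * Real.exp (-(Real.pi / √2) * (mesh * K - τ)) * (eta f).toReal) := by
  set r := Real.exp (-Real.pi / 2) with hr
  have hr0 : 0 < r := Real.exp_pos _
  have hr1 : r ≤ 9 / 40 := exp_neg_half_pi_le
  set η := (eta f).toReal with hηdef
  have hη0 : 0 ≤ η := ENNReal.toReal_nonneg
  have hdiv : Real.pi / √2 = Real.pi * mesh := by
    rw [mesh, mul_one_div]
  have hexp : ∀ n : ℕ, Real.exp (-(Real.pi / √2) * (mesh * n - τ)) =
      Real.exp (Real.pi / √2 * τ) * r ^ n := by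
    intro n
    rw [hr, ← Real.exp_nat_mul, ← Real.exp_add, hdiv]
    congr 1
    linear_combination (-Real.pi * n) * mesh_sq
  have hfib : ∀ k : ℤ, ‖restrictL2 τ (frameInv (∑' l : ℤ, timeTail K f (k, l) •
      gaborAtom (k, l)))‖ ≤ 17 / 4 * √(τ + 1) * η * Real.exp (Real.pi / √2 * τ) *
        (if K < k.natAbs then r ^ k.natAbs else 0) := by
    intro k
    by_cases hk : K < k.natAbs
    · simp only [timeTail, hk, if_true]
      refine (norm_restrictL2_frameInv_tsum_le hτ k f hη).trans_eq ?_
      have : |(k : ℝ)| = (k.natAbs : ℝ) := by rw [Nat.cast_natAbs, Int.cast_abs]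
      rw [this, hexp]
      ring
    · simp [timeTail, hk]
  have hsum := ((hs.hasSum.prod_fiberwise fun k => (hs.prod_factor k).hasSum).mapL
    frameInv).mapL (restrictL2 τ)
  have hbd := (hasSum_ite_pow_natAbs hr0.le (by linarith) K).mul_left
    (17 / 4 * √(τ + 1) * η * Real.exp (Real.pi / √2 * τ))
  have h1 := tsum_of_norm_bounded hbd hfib
  rw [hsum.tsum_eq] at h1
  refine h1.trans ?_
  rw [hexp, pow_succ]
  have h2 : r / (1 - r) ≤ 9 / 31 := by
    rw [div_le_div_iff₀ (by linarith) (by norm_num)]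
    linarith
  calc _ = 17 / 2 * (r / (1 - r)) * (√(τ + 1) * (Real.exp (Real.pi / √2 * τ) * r ^ K) * η) := by
        ring
    _ ≤ 17 / 2 * (9 / 31) * (√(τ + 1) * (Real.exp (Real.pi / √2 * τ) * r ^ K) * η) := by
        gcongr
    _ ≤ _ := by
        gcongr ?_ * _
        norm_num

/-- The lattice is partitioned into the box, the frequencies above and below it, and all remaining
columns in full. Only the last piece uses the restriction to `(-τ, τ)`. -/
theorem norm_restrictL2_sub_sum_le {τ : ℝ} (hτ : 0 < τ) (K L : ℕ) (f : L2) (d : ℤ × ℤ → ℂ)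
    (hκ : kappa (mesh * L) f ≠ ∞) (hη : eta f ≠ ∞) :
    ‖restrictL2 τ (f - ∑ z ∈ indexBox K L, d z • frameInv (gaborAtom z))‖ ≤
      3 / 2 * √(∑ z ∈ indexBox K L, ‖inner ℂ (gaborAtom z) f - d z‖ ^ 2)
        + 9 / 2 * (√(mesh * K + 1) * (kappa (mesh * L) f).toReal)
        + 5 / 2 * (√(τ + 1) * Real.exp (-(Real.pi / √2) * (mesh * K - τ)) * (eta f).toReal) := by
  classical
  let boxPart : ℤ × ℤ → ℂ := fun z =>
    if z ∈ indexBox K L then inner ℂ (gaborAtom z) f - d z else 0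
  have hG := isBessel_gaborAtom.summable_sq_inner (by norm_num) f
  have hbox0 : ∀ z ∉ indexBox K L, boxPart z = 0 := fun z hz => if_neg hz
  have hboxsq : Summable fun z => ‖boxPart z‖ ^ 2 :=
    summable_of_ne_finset_zero (s := indexBox K L) fun z hz => by simp [hbox0 z hz]
  have hfreqsq : Summable fun z => ‖frequencyTail K L f z‖ ^ 2 :=
    Summable.of_nonneg_of_le (fun _ => sq_nonneg _) (fun z => by
      unfold frequencyTail
      split_ifs
      · exact le_rfl
      · simp) hG
  have htimesq : Summable fun z => ‖timeTail K f z‖ ^ 2 :=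
    Summable.of_nonneg_of_le (fun _ => sq_nonneg _) (fun z => by
      unfold timeTail
      split_ifs
      · exact le_rfl
      · simp) hG
  have hB : (0 : ℝ) ≤ (201 / 100) ^ 2 := by norm_num
  have hbox := isBessel_gaborAtom.summable_smul hB hboxsq
  have hfreq := isBessel_gaborAtom.summable_smul hB hfreqsq
  have htime := isBessel_gaborAtom.summable_smul hB htimesq
  have hdecomp : f - ∑ z ∈ indexBox K L, d z • frameInv (gaborAtom z) =
      frameInv (∑' z, boxPart z • gaborAtom z)
        + frameInv (∑' z, frequencyTail K L f z • gaborAtom z)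
        + frameInv (∑' z, timeTail K f z • gaborAtom z) := by
    have h1 : HasSum (fun z => if z ∈ indexBox K L then d z • frameInv (gaborAtom z) else 0)
        (∑ z ∈ indexBox K L, if z ∈ indexBox K L then d z • frameInv (gaborAtom z) else 0) :=
      hasSum_sum_of_ne_finset_zero fun z hz => if_neg hz
    rw [Finset.sum_congr rfl fun z hz => if_pos hz] at h1
    refine ((hasSum_reconstruction f).sub h1).unique ?_
    refine (((hbox.hasSum.mapL frameInv).add (hfreq.hasSum.mapL frameInv)).add
      (htime.hasSum.mapL frameInv)).congr_fun fun z => ?_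
    simp only [map_smul, boxPart, frequencyTail, timeTail, mem_indexBox]
    by_cases hz1 : z.1.natAbs ≤ K <;> by_cases hz2 : z.2.natAbs ≤ L <;>
      simp [hz1, hz2, sub_smul, not_lt.2, not_le.1]
  rw [hdecomp, map_add, map_add]
  refine (norm_add₃_le).trans (add_le_add_three ?_ ?_ ?_)
  · refine (norm_restrictL2_le _ _).trans (norm_frameInv_tsum_le hboxsq (Real.sqrt_nonneg _) ?_)
    rw [Real.sq_sqrt (Finset.sum_nonneg fun _ _ => sq_nonneg _),
      tsum_eq_sum (s := indexBox K L) fun z hz => by simp [hbox0 z hz]]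
    exact le_of_eq (Finset.sum_congr rfl fun z hz => by simp [boxPart, hz])
  · refine (norm_restrictL2_le _ _).trans ((norm_frameInv_tsum_le hfreqsq
      (X := 3 * (√(mesh * K + 1) * (kappa (mesh * L) f).toReal)) (by positivity) ?_).trans_eq ?_)
    · exact hfreqsq.tsum_le_of_sum_le (sum_sq_frequencyTail_le K L f hκ)
    · ring
  · exact norm_restrictL2_timeTail_le hτ K f hη htime

/-! ### The index set -/

theorem box_eq_map (K L : ℕ) :
    box (mesh * K) (mesh * L) = (indexBox K L).map ⟨latticePoint, latticePoint_injective⟩ := by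
  have hm := mesh_pos
  have key : ∀ (n : ℤ) (N : ℕ), (-(mesh * N) ≤ mesh * n ∧ mesh * n ≤ mesh * N) ↔ n.natAbs ≤ N := by
    intro n N
    rw [← mul_neg, mul_le_mul_iff_right₀ hm, mul_le_mul_iff_right₀ hm]
    have : (-(N : ℝ) ≤ n ∧ (n : ℝ) ≤ N) ↔ (-(N : ℤ) ≤ n ∧ n ≤ (N : ℤ)) := by
      constructor <;> rintro ⟨h1, h2⟩ <;> exact ⟨by exact_mod_cast h1, by exact_mod_cast h2⟩
    rw [this]
    omega
  ext p
  simp only [box, Set.Finite.mem_toFinset, Finset.mem_map, Function.Embedding.coeFn_mk,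
    mem_indexBox]
  constructor
  · rintro ⟨⟨h1, h2⟩, ⟨z, rfl⟩⟩
    exact ⟨z, ⟨(key _ _).1 h1, (key _ _).1 h2⟩, rfl⟩
  · rintro ⟨z, ⟨h1, h2⟩, rfl⟩
    exact ⟨⟨(key _ _).2 h1, (key _ _).2 h2⟩, ⟨z, rfl⟩⟩

theorem sum_box_eq {M : Type*} [AddCommMonoid M] (K L : ℕ)
    (c : box (mesh * K) (mesh * L) → ℂ) (Φ : ℂ → ℝ × ℝ → M) :
    ∑ p : box (mesh * K) (mesh * L), Φ (c p) p = ∑ z ∈ indexBox K L,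
      Φ (Function.extend Subtype.val c 0 (latticePoint z)) (latticePoint z) := by
  have h : ∀ p : box (mesh * K) (mesh * L),
      Φ (c p) p = Φ (Function.extend Subtype.val c 0 (p : ℝ × ℝ)) p := fun p => by
    rw [Subtype.val_injective.extend_apply]
  generalize Function.extend Subtype.val c 0 = c' at h ⊢
  rw [Finset.sum_congr rfl fun p _ => h p,
    Finset.sum_coe_sort (box (mesh * K) (mesh * L)) (fun p => Φ (c' p) p), box_eq_map,
    Finset.sum_map]
  rfl

end Gabor

end

/-! ### The reconstruction estimate in extended nonnegative reals -/

theorem theorem2 (T S τ : ℝ) (hT : ∃ K : ℕ, T = Gabor.mesh * K)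
    (hS : ∃ L : ℕ, S = Gabor.mesh * L) (hτ : 0 < τ) (hτT : τ < T)
    (f : Gabor.L2) (c : Gabor.box T S → ℂ) :
    eLpNorm (f - Gabor.synthesis (Gabor.box T S) c : Gabor.L2) 2
        (volume.restrict (Ioo (-τ) τ)) ≤
      ENNReal.ofReal 6.82 *
        (ENNReal.ofReal (Gabor.l2Norm fun p : Gabor.box T S => Gabor.gaborTransform f p - c p)
          + ENNReal.ofReal √(T + 1) * Gabor.kappa S f
          + ENNReal.ofReal (√(τ + 1) * Real.exp (-(Real.pi / √2) * (T - τ))) * Gabor.eta f) := by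
  obtain ⟨K, rfl⟩ := hT
  obtain ⟨L, rfl⟩ := hS
  have hm := Gabor.mesh_pos
  have hs1 : 0 < √(Gabor.mesh * K + 1) := Real.sqrt_pos.2 (by positivity)
  have hs2 : 0 < √(τ + 1) * Real.exp (-(Real.pi / √2) * (Gabor.mesh * K - τ)) :=
    mul_pos (Real.sqrt_pos.2 (by linarith)) (Real.exp_pos _)
  have hconst : ENNReal.ofReal 6.82 ≠ 0 := by
    rw [Ne, ENNReal.ofReal_eq_zero]
    norm_num
  -- An infinite `kappa` or `eta` has a nonzero coefficient and makes the right side infinite, so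
  -- finiteness need not be proved.
  by_cases hκ : Gabor.kappa (Gabor.mesh * L) f = ∞
  · rw [hκ, ENNReal.mul_top (ENNReal.ofReal_pos.2 hs1).ne', add_top,
      top_add, ENNReal.mul_top hconst]
    exact le_top
  by_cases hη : Gabor.eta f = ∞
  · rw [hη, ENNReal.mul_top (ENNReal.ofReal_pos.2 hs2).ne', add_top, ENNReal.mul_top hconst]
    exact le_top
  have hsyn : Gabor.synthesis (Gabor.box (Gabor.mesh * K) (Gabor.mesh * L)) c =
      ∑ z ∈ Gabor.indexBox K L, Function.extend Subtype.val c 0 (Gabor.latticePoint z) •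
        Gabor.frameInv (Gabor.gaborAtom z) := by
    rw [Gabor.synthesis,
      Gabor.sum_box_eq K L c fun a p => a • Gabor.tfShift p Gabor.dualWindow]
    exact Finset.sum_congr rfl fun z _ => by
      rw [Gabor.latticePoint, Gabor.tfShift_dualWindow]
  have hl2 : Gabor.l2Norm (fun p : Gabor.box (Gabor.mesh * K) (Gabor.mesh * L) =>
      Gabor.gaborTransform f p - c p) = √(∑ z ∈ Gabor.indexBox K L,
        ‖inner ℂ (Gabor.gaborAtom z) f -
          Function.extend Subtype.val c 0 (Gabor.latticePoint z)‖ ^ 2) := by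
    rw [Gabor.l2Norm, Gabor.sum_box_eq K L c fun a p => ‖Gabor.gaborTransform f p - a‖ ^ 2]
    rfl
  have hmain := Gabor.norm_restrictL2_sub_sum_le hτ K L f
    (fun z => Function.extend Subtype.val c 0 (Gabor.latticePoint z)) hκ hη
  rw [Gabor.eLpNorm_restrict_eq, hsyn, hl2, ← ENNReal.ofReal_toReal hκ,
    ← ENNReal.ofReal_toReal hη, ← ENNReal.ofReal_mul hs1.le, ← ENNReal.ofReal_mul hs2.le,
    ← ENNReal.ofReal_add (Real.sqrt_nonneg _) (by positivity),
    ← ENNReal.ofReal_add (by positivity) (by positivity), ← ENNReal.ofReal_mul (by norm_num)]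
  refine ENNReal.ofReal_le_ofReal (hmain.trans ?_)
  rw [mul_add, mul_add]
  -- The constants obtained are `3/2`, `9/2` and `5/2`, all below `6.82`.
  refine add_le_add_three ?_ ?_ ?_ <;>
    exact mul_le_mul_of_nonneg_right (by norm_num) (by positivity)
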